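/- Let $\gamma=(\gamma_1,\gamma_2,\gamma_3)\in\mathbb C^3$ satisfy $\mathrm{Im}\,\gamma_i<\tfrac12$ for $i=1,2,3$, $\mathrm{Im}(\gamma_1-\gamma_2)>-\tfrac12$ and $\mathrm{Im}(\gamma_2-\gamma_3)>-\tfrac12$ (for example $\gamma=(\lambda_1+\imath\varepsilon,\lambda_2-\imath\varepsilon,\lambda_3)$ with $\lambda\in\mathbb R^3$ and $0\le\varepsilon<\tfrac12$), and let $x=(x_1,x_2,x_3)\in\mathbb R^3$. Consider the modified Gauss–Givental integral for the $\mathfrak{gl}_3(\mathbb R)$-Whittaker function $$ \Psi^{GG}_{\gamma}(x)=\frac{e^{\imath(\gamma_1x_1+\gamma_2x_2+\gamma_3x_3)-x_1+x_3}}{(2\pi)^3}\int_{\mathbb R^3}ds_{11}\,ds_{21}\,ds_{22}\;e^{\imath s_{21}(x_1-x_2)+\imath s_{11}(x_1-x_3)+\imath s_{22}(x_2-x_3)}\, \Gamma\bigl(\tfrac12-\imath s_{21}\bigr)\Gamma\bigl(\tfrac12-\imath s_{11}\bigr)\Gamma\bigl(1-\imath s_{11}-\imath s_{22}\bigr) $$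 $$ \qquad\times\,\Gamma\bigl(1-\imath(\gamma_1-\gamma_3+s_{11}+s_{21})\bigr)\,\Gamma\bigl(\tfrac12-\imath(\gamma_2-\gamma_3+s_{22})\bigr)\,\Gamma\bigl(\tfrac12-\imath(\gamma_1-\gamma_2+s_{11})\bigr) $$ and the Mellin–Barnes integral $$ \Psi^{MB}_{\gamma}(x)=\frac{e^{\imath(\gamma_1+\gamma_2+\gamma_3)x_3-(x_1-x_3)}}{(2\pi)^3}\int_{\mathbb R^3}\frac{d\tau_{11}\,d\tau_{21}\,d\tau_{22}}{\Gamma(\imath\tau_{21}-\imath\tau_{22})\,\Gamma(\imath\tau_{22}-\imath\tau_{21})}\;e^{\imath(x_2-x_3)(\tau_{21}+\tau_{22})+\imath(x_1-x_2)\tau_{11}} $$ $$ \qquad\times\,\Gamma\bigl(\imath(\tau_{21}-\tau_{11})+\tfrac12\bigr)\,\Gamma\bigl(\imath(\tau_{22}-\tau_{11})+\tfrac12\bigr)\prod_{i=1}^3\prod_{j=1}^2\Gamma\bigl(\imath(\gamma_i-\tau_{2j})+\tfrac12\bigr). $$ Then both integrals converge absolutely, and $\Psi^{GG}_{\gamma}(x)=\frac1{2!}\,\Psi^{MB}_{\gamma}(x)$;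 that is, the two integrals coincide when the Mellin–Barnes integral is normalized by $\frac{1}{2!\,(2\pi)^3}$. -/

import Mathlib

open Complex MeasureTheory

noncomputable section

/-- The integrand of the modified Gauss-Givental integral for the `gl₃(ℝ)`-Whittaker function;
the integration variable is `s = (s₁₁, s₂₁, s₂₂)`, and `γ 0, γ 1, γ 2` (resp. `x 0, x 1, x 2`) are
`γ₁, γ₂, γ₃` (resp. `x₁, x₂, x₃`). -/
def gaussGiventalIntegrand (γ : Fin 3 → ℂ) (x : Fin 3 → ℝ) (s : ℝ × ℝ × ℝ) : ℂ :=
  let s₁₁ : ℂ := (s.1 : ℂ)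
  let s₂₁ : ℂ := (s.2.1 : ℂ)
  let s₂₂ : ℂ := (s.2.2 : ℂ)
  exp (I * s₂₁ * (x 0 - x 1) + I * s₁₁ * (x 0 - x 2) + I * s₂₂ * (x 1 - x 2))
    * Gamma (1 / 2 - I * s₂₁) * Gamma (1 / 2 - I * s₁₁) * Gamma (1 - I * s₁₁ - I * s₂₂)
    * Gamma (-I * (γ 0 - γ 2 + s₁₁ + s₂₁) + 1)
    * Gamma (-I * (γ 1 - γ 2 + s₂₂) + 1 / 2)
    * Gamma (-I * (γ 0 - γ 1 + s₁₁) + 1 / 2)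

/-- The modified Gauss-Givental integral for the `gl₃(ℝ)`-Whittaker function. -/
def gaussGiventalIntegral (γ : Fin 3 → ℂ) (x : Fin 3 → ℝ) : ℂ :=
  exp (I * (γ 0 * x 0 + γ 1 * x 1 + γ 2 * x 2) - x 0 + x 2) / (2 * Real.pi : ℂ) ^ 3
    * ∫ s : ℝ × ℝ × ℝ, gaussGiventalIntegrand γ x s

/-- The integrand of the Mellin-Barnes integral for the `gl₃(ℝ)`-Whittaker function;
the integration variable is `τ = (τ₁₁, τ₂₁, τ₂₂)`. On the null set `τ₂₁ = τ₂₂`, where both Gamma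
functions in the denominator have a pole, the quotient has the value `0`, which is also the value
of its continuous extension. -/
def mellinBarnesIntegrand (γ : Fin 3 → ℂ) (x : Fin 3 → ℝ) (τ : ℝ × ℝ × ℝ) : ℂ :=
  let τ₁₁ : ℂ := (τ.1 : ℂ)
  let τ₂₁ : ℂ := (τ.2.1 : ℂ)
  let τ₂₂ : ℂ := (τ.2.2 : ℂ)
  1 / (Gamma (I * τ₂₁ - I * τ₂₂) * Gamma (I * τ₂₂ - I * τ₂₁))
    * exp (I * (x 1 - x 2) * (τ₂₁ + τ₂₂) + I * (x 0 - x 1) * τ₁₁)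
    * Gamma (I * (τ₂₁ - τ₁₁) + 1 / 2) * Gamma (I * (τ₂₂ - τ₁₁) + 1 / 2)
    * ∏ i : Fin 3, (Gamma (I * (γ i - τ₂₁) + 1 / 2) * Gamma (I * (γ i - τ₂₂) + 1 / 2))

/-- The Mellin-Barnes integral for the `gl₃(ℝ)`-Whittaker function, without the symmetry factor
`1 / 2!` that accounts for the permutations of `τ₂₁, τ₂₂`; here `ρ(x) = x₁ - x₃`. -/
def mellinBarnesIntegral (γ : Fin 3 → ℂ) (x : Fin 3 → ℝ) : ℂ :=
  exp (I * (γ 0 + γ 1 + γ 2) * x 2 - (x 0 - x 2)) / (2 * Real.pi : ℂ) ^ 3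
    * ∫ τ : ℝ × ℝ × ℝ, mellinBarnesIntegrand γ x τ

end

/-! Both triple integrals are one inner integration away from the same double integral, that of
`whittakerKernel`. In the Mellin–Barnes integral put t = τ₁₁, w = τ₂₁ + τ₂₂ and let u be half of τ₂₁
- τ₂₂. For fixed t, w the integral over u is a de Branges–Wilson integral, and `wilsonIntegral_eq`
gives 4π times the kernel at the real point (t, w). In the Gauss–Givental integral fix p = s₁₁ + s₂₁
and q = s₁₁ + s₂₂. The integral over s₁₁ is then evaluated by Barnes' first lemma
(`integral_barnes_first`) and gives 2π times the kernel at (γ₁ + p, γ₁ + γ₂ + q), up to an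
exponential prefactor. The hypotheses on Im γ keep the strips between the two pairs of contours free
of poles, so `integral_whittakerKernel_shift` identifies the double integrals. The quotient 2π / 4π
is the factor 1/2!.

Barnes' first lemma is the Parseval formula for Beta densities in the logistic coordinate, whose
Fourier transforms are products of two Gamma functions. For the de Branges–Wilson integral, the
integral and its conjectural value obey the same recurrence under a ↦ a + 1. Their quotient is
therefore periodic in a, holomorphic for Re a > 0 and of polynomial growth, hence constant. By
symmetry it depends on none of the four parameters, and at (1/2, 1/2, 1/2, 1) the integral reduces
to Barnes' lemma. -/

/-! ### Growth of the Gamma function on vertical lines and strips. -/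

/-- The function `σ ↦ ‖Γ(σ + it)‖ / Γ(σ)` is nondecreasing on `(0, ∞)`. -/
theorem norm_Gamma_mul_Gamma_re_add_le {z : ℂ} (hz : 0 < z.re) {s : ℝ} (hs : 0 ≤ s) :
    ‖Gamma z‖ * Real.Gamma (z.re + s) ≤ ‖Gamma (z + s)‖ * Real.Gamma z.re := by
  rcases hs.eq_or_lt with rfl | hs
  · simp
  -- The quotient Γ(z)Γ(s)/Γ(z + s) is a Beta integral, and taking absolute values inside it
  -- replaces z by its real part.
  have hB : ‖betaIntegral z s‖ ≤ ‖betaIntegral (z.re : ℂ) s‖ := by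
    have h1 : betaIntegral (z.re : ℂ) s
        = ((∫ x in (0 : ℝ)..1, x ^ (z.re - 1) * (1 - x) ^ (s - 1) : ℝ) : ℂ) := by
      rw [betaIntegral, ← intervalIntegral.integral_ofReal]
      refine intervalIntegral.integral_congr_ae (Filter.Eventually.of_forall fun x hx ↦ ?_)
      rw [Set.uIoc_of_le zero_le_one] at hx
      rw [ofReal_mul, ofReal_cpow hx.1.le, ofReal_cpow (by linarith [hx.2])]
      push_cast; rfl
    rw [h1, betaIntegral, norm_real, Real.norm_eq_abs]
    refine (intervalIntegral.norm_integral_le_integral_norm zero_le_one).trans ?_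
    refine (le_of_eq ?_).trans (le_abs_self _)
    rw [intervalIntegral.integral_of_le zero_le_one, intervalIntegral.integral_of_le zero_le_one,
      integral_Ioc_eq_integral_Ioo, integral_Ioc_eq_integral_Ioo]
    refine setIntegral_congr_fun measurableSet_Ioo fun x hx ↦ ?_
    have h2 : (1 : ℂ) - x = ((1 - x : ℝ) : ℂ) := by push_cast; rfl
    simp only [norm_mul]
    rw [norm_cpow_eq_rpow_re_of_pos hx.1, h2,
      norm_cpow_eq_rpow_re_of_pos (by linarith [hx.2])]
    simp
  have e1 := congrArg norm (Gamma_mul_Gamma_eq_betaIntegral hz (t := (s : ℂ)) (by simpa using hs))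
  have e2 := congrArg norm (Gamma_mul_Gamma_eq_betaIntegral (s := (z.re : ℂ)) (t := (s : ℂ))
    (by simpa using hz) (by simpa using hs))
  rw [← ofReal_add, Gamma_ofReal, Gamma_ofReal, Gamma_ofReal, norm_mul, norm_mul, norm_real,
    norm_real, norm_real, Real.norm_of_nonneg (Real.Gamma_pos_of_pos hz).le,
    Real.norm_of_nonneg (Real.Gamma_pos_of_pos hs).le,
    Real.norm_of_nonneg (Real.Gamma_pos_of_pos (add_pos hz hs)).le] at e2
  rw [norm_mul, norm_mul, Gamma_ofReal, norm_real,
    Real.norm_of_nonneg (Real.Gamma_pos_of_pos hs).le] at e1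
  have hg := Real.Gamma_pos_of_pos hs
  have hg' := Real.Gamma_pos_of_pos (add_pos hz hs)
  refine le_of_mul_le_mul_right ?_ hg
  calc ‖Gamma z‖ * Real.Gamma (z.re + s) * Real.Gamma s
      = (‖Gamma (z + s)‖ * ‖betaIntegral z s‖) * Real.Gamma (z.re + s) := by rw [← e1]; ring
    _ ≤ (‖Gamma (z + s)‖ * ‖betaIntegral (z.re : ℂ) s‖) * Real.Gamma (z.re + s) := by gcongr
    _ = ‖Gamma (z + s)‖ * (Real.Gamma z.re * Real.Gamma s) := by rw [e2]; ring
    _ = _ := by ring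

/-- On the line Re z = 1/2 one has 1 - z = conj z, so the reflection formula computes |Γ(z)|²
exactly. -/
theorem norm_Gamma_one_half_add_mul_I_sq (t : ℝ) :
    ‖Gamma (1 / 2 + t * I)‖ ^ 2 = Real.pi / Real.cosh (Real.pi * t) := by
  have h1 := Gamma_mul_Gamma_one_sub (1 / 2 + t * I)
  have h2 : (1 : ℂ) - (1 / 2 + t * I) = (starRingEnd ℂ) (1 / 2 + t * I) := by
    apply Complex.ext <;> norm_num
  have h3 : (Real.pi : ℂ) * (1 / 2 + t * I) = Real.pi / 2 + (Real.pi * t : ℝ) * I := by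
    push_cast; ring
  rw [h2, Gamma_conj, mul_conj, h3, Complex.sin_add, sin_pi_div_two, cos_pi_div_two, cos_mul_I,
    ← ofReal_cosh, zero_mul, one_mul, add_zero, ← ofReal_div, ofReal_inj, normSq_eq_norm_sq] at h1
  exact h1

theorem Real.cosh_le_exp_abs (x : ℝ) : Real.cosh x ≤ Real.exp |x| := by
  rw [← Real.cosh_abs, Real.cosh_eq]
  have := Real.exp_le_exp.2 (show -|x| ≤ |x| by linarith [abs_nonneg x])
  linarith

theorem Real.exp_abs_le_two_mul_cosh (x : ℝ) : Real.exp |x| ≤ 2 * Real.cosh x := by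
  rw [← Real.cosh_abs, Real.cosh_eq]
  have := Real.exp_pos (-|x|)
  linarith

theorem norm_Gamma_one_half_add_mul_I_le (t : ℝ) :
    ‖Gamma (1 / 2 + t * I)‖ ≤ √(2 * Real.pi) * Real.exp (-(Real.pi / 2 * |t|)) := by
  refine le_of_sq_le_sq ?_ (by positivity)
  rw [norm_Gamma_one_half_add_mul_I_sq, mul_pow, Real.sq_sqrt (by positivity), ← Real.exp_nat_mul,
    div_le_iff₀ (Real.cosh_pos _)]
  have h := Real.exp_abs_le_two_mul_cosh (Real.pi * t)
  rw [abs_mul, abs_of_pos Real.pi_pos] at h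
  have h2 : ((2 : ℕ) : ℝ) * -(Real.pi / 2 * |t|) = -(Real.pi * |t|) := by push_cast; ring
  rw [h2]
  calc Real.pi = Real.pi * (Real.exp (-(Real.pi * |t|)) * Real.exp (Real.pi * |t|)) := by
        rw [← Real.exp_add]; simp
    _ ≤ Real.pi * (Real.exp (-(Real.pi * |t|)) * (2 * Real.cosh (Real.pi * t))) := by gcongr
    _ = _ := by ring

theorem le_norm_Gamma_one_half_add_mul_I (t : ℝ) :
    √Real.pi * Real.exp (-(Real.pi / 2 * |t|)) ≤ ‖Gamma (1 / 2 + t * I)‖ := by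
  refine le_of_sq_le_sq ?_ (by positivity)
  rw [norm_Gamma_one_half_add_mul_I_sq, mul_pow, Real.sq_sqrt (by positivity), ← Real.exp_nat_mul,
    le_div_iff₀ (Real.cosh_pos _)]
  have h := Real.cosh_le_exp_abs (Real.pi * t)
  rw [abs_mul, abs_of_pos Real.pi_pos] at h
  have h2 : ((2 : ℕ) : ℝ) * -(Real.pi / 2 * |t|) = -(Real.pi * |t|) := by push_cast; ring
  rw [h2]
  calc _ ≤ Real.pi * Real.exp (-(Real.pi * |t|)) * Real.exp (Real.pi * |t|) := by gcongr
    _ = Real.pi := by rw [mul_assoc, ← Real.exp_add]; simp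

theorem exists_norm_Gamma_nat_add_one_half_le (n : ℕ) : ∃ C : ℝ, 0 < C ∧ ∀ t : ℝ,
    ‖Gamma (n + 1 / 2 + t * I)‖ ≤ C * (1 + |t|) ^ n * Real.exp (-(Real.pi / 2 * |t|)) := by
  induction n with
  | zero => exact ⟨√(2 * Real.pi), by positivity, fun t ↦ by
      simpa using norm_Gamma_one_half_add_mul_I_le t⟩
  | succ n ih =>
    obtain ⟨C, hC, h⟩ := ih
    refine ⟨(n + 1) * C, by positivity, fun t ↦ ?_⟩
    have h0 : (n + 1 / 2 + t * I : ℂ) ≠ 0 := fun h ↦ by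
      have := congrArg re h
      simp at this
      have h3 : (0 : ℝ) ≤ n := n.cast_nonneg
      linarith
    have h1 : ((n + 1 : ℕ) + 1 / 2 + t * I : ℂ) = (n + 1 / 2 + t * I) + 1 := by push_cast; ring
    have h2 : ‖(n + 1 / 2 + t * I : ℂ)‖ ≤ (n + 1) * (1 + |t|) := by
      refine (norm_add_le _ _).trans ?_
      have : ‖(n + 1 / 2 : ℂ)‖ = n + 1 / 2 := by
        rw [show (n + 1 / 2 : ℂ) = ((n + 1 / 2 : ℝ) : ℂ) by push_cast; rfl, norm_real,
          Real.norm_of_nonneg (by positivity)]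
      rw [this, norm_mul, norm_I, norm_real, Real.norm_eq_abs]
      nlinarith [mul_nonneg n.cast_nonneg (abs_nonneg t), abs_nonneg t]
    rw [h1, Gamma_add_one _ h0, norm_mul]
    calc _ ≤ ((n + 1) * (1 + |t|)) * (C * (1 + |t|) ^ n * Real.exp (-(Real.pi / 2 * |t|))) := by
          gcongr; exact h t
      _ = _ := by ring

theorem Real.continuousOn_Gamma_Icc {a b : ℝ} (ha : 0 < a) :
    ContinuousOn Real.Gamma (Set.Icc a b) := fun x hx ↦
  (Real.differentiableAt_Gamma fun m ↦ by
    have := hx.1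
    have h3 : (0 : ℝ) ≤ m := m.cast_nonneg
    linarith).continuousAt.continuousWithinAt

/-- On a vertical strip in the right half plane, the Gamma function has polynomial growth times
`exp(-π|t|/2)`. -/
theorem exists_norm_Gamma_le {δ : ℝ} (hδ : 0 < δ) (M : ℝ) : ∃ (C : ℝ) (n : ℕ), 0 < C ∧ ∀ z : ℂ,
    δ ≤ z.re → z.re ≤ M →
      ‖Gamma z‖ ≤ C * (1 + |z.im|) ^ n * Real.exp (-(Real.pi / 2 * |z.im|)) := by
  obtain ⟨K, hK⟩ := isCompact_Icc.bddAbove_image (Real.continuousOn_Gamma_Icc (b := M) hδ)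
  set n := ⌈M⌉₊
  obtain ⟨C, hC, h⟩ := exists_norm_Gamma_nat_add_one_half_le n
  have hG : 0 < Real.Gamma (n + 1 / 2) := Real.Gamma_pos_of_pos (by positivity)
  refine ⟨C * (|K| + 1) / Real.Gamma (n + 1 / 2), n, by positivity, fun z h1 h2 ↦ ?_⟩
  have hn : M ≤ n := Nat.le_ceil M
  have hz : 0 < z.re := hδ.trans_le h1
  -- Monotonicity compares z with the point at the same height on the line Re = n + 1/2, to the
  -- right of the strip, where the bound is known.
  have key := norm_Gamma_mul_Gamma_re_add_le hz (s := n + 1 / 2 - z.re) (by linarith)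
  have e1 : z + ((n + 1 / 2 - z.re : ℝ) : ℂ) = n + 1 / 2 + z.im * I := by
    apply Complex.ext <;> simp
  rw [e1, add_sub_cancel] at key
  have hK' : Real.Gamma z.re ≤ |K| + 1 := by
    have := hK (Set.mem_image_of_mem _ ⟨h1, h2⟩)
    linarith [le_abs_self K]
  rw [div_mul_eq_mul_div, div_mul_eq_mul_div, le_div_iff₀ hG]
  calc _ ≤ _ := key
    _ ≤ (C * (1 + |z.im|) ^ n * Real.exp (-(Real.pi / 2 * |z.im|))) * (|K| + 1) :=
        mul_le_mul (h _) hK' (Real.Gamma_pos_of_pos hz).le (by positivity)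
    _ = _ := by ring

/-- Here monotonicity is used leftwards, against the line Re = 1/2, where |Γ| is known from below;
hence no polynomial factor appears. -/
theorem exists_norm_Gamma_inv_le (M : ℝ) : ∃ C : ℝ, 0 < C ∧ ∀ z : ℂ, 1 / 2 ≤ z.re → z.re ≤ M →
    ‖(Gamma z)⁻¹‖ ≤ C * Real.exp (Real.pi / 2 * |z.im|) := by
  have hc : ContinuousOn (fun x ↦ (Real.Gamma x)⁻¹) (Set.Icc (1 / 2) M) :=
    (Real.continuousOn_Gamma_Icc (by norm_num)).inv₀ fun x hx ↦
      (Real.Gamma_pos_of_pos (by linarith [hx.1])).ne'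
  obtain ⟨K, hK⟩ := isCompact_Icc.bddAbove_image hc
  have hG : 0 < Real.Gamma (1 / 2) := Real.Gamma_pos_of_pos (by norm_num)
  refine ⟨Real.Gamma (1 / 2) * (|K| + 1) / √Real.pi, by positivity, fun z h1 h2 ↦ ?_⟩
  have hz : 0 < z.re := by linarith
  have key := norm_Gamma_mul_Gamma_re_add_le (z := 1 / 2 + z.im * I) (by simp)
    (s := z.re - 1 / 2) (by linarith)
  have e1 : (1 / 2 + z.im * I : ℂ) + ((z.re - 1 / 2 : ℝ) : ℂ) = z := by
    apply Complex.ext <;> simp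
  have e2 : (1 / 2 + z.im * I : ℂ).re = 1 / 2 := by simp
  rw [e1, e2, add_sub_cancel] at key
  have hK' : (Real.Gamma z.re)⁻¹ ≤ |K| + 1 := by
    have := hK (Set.mem_image_of_mem _ ⟨h1, h2⟩)
    linarith [le_abs_self K]
  have hgz := Real.Gamma_pos_of_pos hz
  have hgz' : 0 < ‖Gamma z‖ := norm_pos_iff.2 (Gamma_ne_zero_of_re_pos hz)
  have hl := (mul_le_mul_of_nonneg_right (le_norm_Gamma_one_half_add_mul_I z.im) hgz.le).trans key
  rw [norm_inv, inv_le_iff_one_le_mul₀ hgz']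
  have hpi : 0 < √Real.pi := Real.sqrt_pos.2 Real.pi_pos
  calc (1 : ℝ) = (√Real.pi * Real.exp (-(Real.pi / 2 * |z.im|)) * Real.Gamma z.re) *
        ((Real.Gamma z.re)⁻¹ / √Real.pi * Real.exp (Real.pi / 2 * |z.im|)) := by
        rw [Real.exp_neg]; field_simp
    _ ≤ (‖Gamma z‖ * Real.Gamma (1 / 2)) *
        ((|K| + 1) / √Real.pi * Real.exp (Real.pi / 2 * |z.im|)) := by gcongr
    _ = _ := by ring

theorem exists_one_add_pow_le_exp (n : ℕ) {ε : ℝ} (hε : 0 < ε) : ∃ C : ℝ, 0 < C ∧ ∀ t : ℝ, 0 ≤ t →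
    (1 + t) ^ n ≤ C * Real.exp (ε * t) := by
  set d := ε / (n + 1)
  have hd : 0 < d := by positivity
  refine ⟨(1 + d⁻¹) ^ n, by positivity, fun t ht ↦ ?_⟩
  have h1 : 1 + t ≤ (1 + d⁻¹) * Real.exp (d * t) := by
    have := Real.add_one_le_exp (d * t)
    calc 1 + t ≤ (1 + d⁻¹) * (d * t + 1) := by
          have : d⁻¹ * (d * t) = t := by field_simp
          nlinarith [inv_pos.2 hd, mul_nonneg hd.le ht]
      _ ≤ _ := by gcongr
  calc (1 + t) ^ n ≤ ((1 + d⁻¹) * Real.exp (d * t)) ^ n := by gcongr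
    _ = (1 + d⁻¹) ^ n * Real.exp (n * (d * t)) := by rw [mul_pow, ← Real.exp_nat_mul]
    _ ≤ (1 + d⁻¹) ^ n * Real.exp (ε * t) := by
      have h2 : (n + 1) * d = ε := by simp only [d]; field_simp
      exact mul_le_mul_of_nonneg_left (Real.exp_le_exp.2 (by nlinarith [mul_nonneg hd.le ht]))
        (by positivity)

/-- The rate 3/2 < π/2 absorbs the polynomial factor, and is still large enough for every comparison
of exponents made later. -/
theorem exists_norm_Gamma_le_exp {δ : ℝ} (hδ : 0 < δ) (M : ℝ) :
    ∃ C : ℝ, 0 < C ∧ ∀ z : ℂ, δ ≤ z.re → z.re ≤ M →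
      ‖Gamma z‖ ≤ C * Real.exp (-(3 / 2 * |z.im|)) := by
  have hε : 0 < Real.pi / 2 - 3 / 2 := by linarith [Real.pi_gt_three]
  obtain ⟨C, n, hC, h⟩ := exists_norm_Gamma_le hδ M
  obtain ⟨D, hD, h'⟩ := exists_one_add_pow_le_exp n hε
  refine ⟨C * D, by positivity, fun z h1 h2 ↦ (h z h1 h2).trans ?_⟩
  calc _ ≤ C * (D * Real.exp ((Real.pi / 2 - 3 / 2) * |z.im|)) *
        Real.exp (-(Real.pi / 2 * |z.im|)) := by
        gcongr; exact h' _ (abs_nonneg _)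
    _ = C * D * (Real.exp ((Real.pi / 2 - 3 / 2) * |z.im|) *
        Real.exp (-(Real.pi / 2 * |z.im|))) := by ring
    _ = _ := by rw [← Real.exp_add]; ring_nf

/-- The reflection formula, valid even at the poles: `Gamma` has value 0 there and 0⁻¹ = 0, which
matches the zeros of z sin(πz). The left side is thus an entire function. -/
theorem inv_Gamma_mul_Gamma_neg (z : ℂ) :
    (Gamma z * Gamma (-z))⁻¹ = -(z * sin (Real.pi * z)) / Real.pi := by
  rcases eq_or_ne z 0 with rfl | hz
  · simp
  have h1 := Gamma_mul_Gamma_one_sub z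
  rw [show 1 - z = -z + 1 by ring, Gamma_add_one _ (neg_ne_zero.2 hz)] at h1
  have h2 : Gamma z * Gamma (-z) = -(Real.pi / (z * sin (Real.pi * z))) := by
    rw [mul_comm z, ← div_div, ← h1]; field_simp
  rw [h2, inv_neg, inv_div, neg_div]

theorem exists_norm_inv_Gamma_mul_Gamma_neg_le : ∃ C : ℝ, 0 < C ∧ ∀ v : ℝ,
    ‖(Gamma (I * v) * Gamma (-(I * v)))⁻¹‖ ≤ C * Real.exp (4 * |v|) := by
  have hε : 0 < 4 - Real.pi := by linarith [Real.pi_lt_four]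
  obtain ⟨D, hD, h'⟩ := exists_one_add_pow_le_exp 1 hε
  refine ⟨D, hD, fun v ↦ ?_⟩
  have e : (Real.pi : ℂ) * (I * v) = (Real.pi * v : ℝ) * I := by push_cast; ring
  rw [inv_Gamma_mul_Gamma_neg, e, sin_mul_I, ← ofReal_sinh, norm_div, norm_neg, norm_mul, norm_mul,
    norm_mul, norm_I, norm_real, norm_real, norm_real, Real.norm_of_nonneg Real.pi_pos.le]
  have h1 : ‖Real.sinh (Real.pi * v)‖ ≤ Real.exp (Real.pi * |v|) := by
    have h := Real.cosh_le_exp_abs (Real.pi * v)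
    rw [abs_mul, abs_of_pos Real.pi_pos] at h
    refine le_trans ?_ h
    rw [Real.norm_eq_abs, Real.abs_sinh, ← Real.cosh_abs]
    exact (Real.sinh_lt_cosh _).le
  have h2 := h' |v| (abs_nonneg v)
  rw [pow_one] at h2
  rw [Real.norm_eq_abs v, div_le_iff₀ Real.pi_pos]
  calc 1 * |v| * (‖Real.sinh (Real.pi * v)‖ * 1)
      ≤ (D * Real.exp ((4 - Real.pi) * |v|)) * Real.exp (Real.pi * |v|) := by
        rw [one_mul, mul_one]
        gcongr
        linarith
    _ = D * Real.exp (4 * |v|) * 1 := by rw [mul_assoc, ← Real.exp_add]; ring_nf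
    _ ≤ _ := by gcongr; linarith [Real.pi_gt_three]

theorem exists_norm_Gamma_add_I_mul_le {a : ℂ} (ha : 0 < a.re) : ∃ C : ℝ, 0 < C ∧ ∀ s : ℝ,
    ‖Gamma (a + I * s)‖ ≤ C * Real.exp (-(3 / 2 * |s|)) := by
  obtain ⟨C, hC, h⟩ := exists_norm_Gamma_le_exp ha a.re
  refine ⟨C * Real.exp (3 / 2 * |a.im|), by positivity, fun s ↦
    (h _ (by simp) (by simp)).trans ?_⟩
  rw [mul_assoc, ← Real.exp_add]
  gcongr
  have h1 : (a + I * s).im = a.im + s := by simp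
  have h2 := abs_sub_abs_le_abs_sub s (-a.im)
  rw [abs_neg, sub_neg_eq_add, add_comm s] at h2
  rw [h1]
  linarith

theorem exists_norm_Gamma_sub_I_mul_le {a : ℂ} (ha : 0 < a.re) : ∃ C : ℝ, 0 < C ∧ ∀ s : ℝ,
    ‖Gamma (a - I * s)‖ ≤ C * Real.exp (-(3 / 2 * |s|)) := by
  obtain ⟨C, hC, h⟩ := exists_norm_Gamma_add_I_mul_le ha
  exact ⟨C, hC, fun s ↦ by simpa [sub_eq_add_neg] using h (-s)⟩

/-! ### Contour shifts and holomorphy of parametric integrals. -/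

theorem Real.integrable_exp_neg_mul_abs {c : ℝ} (hc : 0 < c) :
    Integrable fun x : ℝ ↦ Real.exp (-(c * |x|)) := by
  rw [← integrableOn_univ, ← Set.Iic_union_Ioi (a := (0 : ℝ)), integrableOn_union]
  constructor
  · refine (integrableOn_exp_mul_Iic hc 0).congr_fun (fun x hx ↦ ?_) measurableSet_Iic
    simp only [abs_of_nonpos (Set.mem_Iic.1 hx)]; ring_nf
  · refine (exp_neg_integrableOn_Ioi 0 hc).congr_fun (fun x hx ↦ ?_) measurableSet_Ioi
    simp only [abs_of_pos (Set.mem_Ioi.1 hx)]; ring_nf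

theorem integrable_add_mul_I_of_norm_le_exp {f : ℂ → ℂ} {c C y : ℝ} (hc : 0 < c)
    (hf : ∀ z : ℂ, z.im = y → DifferentiableAt ℂ f z)
    (hb : ∀ z : ℂ, z.im = y → ‖f z‖ ≤ C * Real.exp (-(c * |z.re|))) :
    Integrable fun x : ℝ ↦ f (x + y * I) := by
  refine ((Real.integrable_exp_neg_mul_abs hc).const_mul C).mono' ?_ (.of_forall fun x ↦ ?_)
  · refine (continuous_iff_continuousAt.2 fun x ↦ ?_).aestronglyMeasurable
    exact ContinuousAt.comp (f := fun x : ℝ ↦ (x + y * I : ℂ)) (g := f)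
      (hf _ (by simp)).continuousAt (by fun_prop)
  · simpa using hb (x + y * I) (by simp)

/-- Contour shift between two horizontal lines for a function that decays exponentially in the
strip between them. -/
theorem integral_add_mul_I_eq_of_norm_le_exp {f : ℂ → ℂ} {a b c C : ℝ} (hc : 0 < c)
    (hf : ∀ z : ℂ, z.im ∈ Set.uIcc a b → DifferentiableAt ℂ f z)
    (hb : ∀ z : ℂ, z.im ∈ Set.uIcc a b → ‖f z‖ ≤ C * Real.exp (-(c * |z.re|))) :
    ∫ x : ℝ, f (x + a * I) = ∫ x : ℝ, f (x + b * I) := by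
  have hint : ∀ y ∈ Set.uIcc a b, Integrable fun x : ℝ ↦ f (x + y * I) := fun y hy ↦
    integrable_add_mul_I_of_norm_le_exp hc (fun z hz ↦ hf z (hz ▸ hy)) fun z hz ↦ hb z (hz ▸ hy)
  have hside : ∀ T : ℝ, 0 ≤ T → ∀ s : ℝ, |s| = T →
      ‖∫ y in a..b, f (s + y * I)‖ ≤ C * Real.exp (-(c * T)) * |b - a| := fun T _ s hs ↦ by
    refine intervalIntegral.norm_integral_le_of_norm_le_const fun y hy ↦ ?_
    simpa [hs] using hb (s + y * I) (by simpa using Set.uIoc_subset_uIcc hy)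
  have hlim : Filter.Tendsto (fun T : ℝ ↦ C * Real.exp (-(c * T)) * |b - a|) Filter.atTop
      (nhds 0) := by
    have : Filter.Tendsto (fun T : ℝ ↦ Real.exp (-(c * T))) Filter.atTop (nhds 0) :=
      Real.tendsto_exp_neg_atTop_nhds_zero.comp (Filter.tendsto_id.const_mul_atTop hc)
    simpa using (this.const_mul C).mul_const |b - a|
  have hz : ∀ s : ℝ → ℝ, (∀ T, |s T| = |T|) →
      Filter.Tendsto (fun T ↦ ∫ y in a..b, f (s T + y * I)) Filter.atTop (nhds 0) := fun s hs ↦ by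
    refine squeeze_zero_norm' ?_ hlim
    filter_upwards [Filter.eventually_ge_atTop 0] with T hT
    exact hside T hT _ (by rw [hs, abs_of_nonneg hT])
  have hrect : ∀ T : ℝ, (∫ x in (-T)..T, f (x + a * I)) - (∫ x in (-T)..T, f (x + b * I))
      + I • (∫ y in a..b, f (T + y * I)) - I • (∫ y in a..b, f ((-T : ℝ) + y * I)) = 0 := fun T ↦ by
    have := integral_boundary_rect_eq_zero_of_differentiableOn f (-T + a * I) (T + b * I)
      fun z hz ↦ (hf z (by simpa using (mem_reProdIm.1 hz).2)).differentiableWithinAt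
    simpa using this
  have h1 := intervalIntegral_tendsto_integral (hint a Set.left_mem_uIcc)
    Filter.tendsto_neg_atTop_atBot Filter.tendsto_id
  have h2 := intervalIntegral_tendsto_integral (hint b Set.right_mem_uIcc)
    Filter.tendsto_neg_atTop_atBot Filter.tendsto_id
  have h3 := ((h1.sub h2).add ((hz id fun _ ↦ rfl).const_smul I)).sub
    ((hz (fun T ↦ -T) fun T ↦ abs_neg T).const_smul I)
  have h4 := tendsto_nhds_unique (h3.congr fun T ↦ hrect T) tendsto_const_nhds
  simpa [sub_eq_zero] using h4

/-- Holomorphy of a parametric integral with a locally uniform integrable majorant. -/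
theorem differentiableOn_integral_of_norm_le {α : Type*} [MeasurableSpace α] {μ : Measure α}
    {U : Set ℂ} (hU : IsOpen U) {F : ℂ → α → ℂ} {g : α → ℝ}
    (hd : ∀ u, DifferentiableOn ℂ (F · u) U) (hm : ∀ a ∈ U, AEStronglyMeasurable (F a) μ)
    (hb : ∀ a ∈ U, ∀ u, ‖F a u‖ ≤ g u) (hg : Integrable g μ) :
    DifferentiableOn ℂ (fun a ↦ ∫ u, F a u ∂μ) U := by
  intro a ha
  obtain ⟨r, hr, hrU⟩ := Metric.isOpen_iff.1 hU a ha
  have hderiv : ∀ u, ∀ x ∈ U, HasDerivAt (F · u) (deriv (F · u) x) x := fun u x hx ↦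
    ((hd u).differentiableAt (hU.mem_nhds hx)).hasDerivAt
  -- Since 1/2 + 1/3 < 1, the Cauchy estimate on circles of radius r/3 bounds the derivative by g /
  -- (r/3) on the ball of radius r/2.
  have hsub : ∀ x ∈ Metric.ball a (r / 2), Metric.closedBall x (r / 3) ⊆ U := fun x hx y hy ↦ by
    refine hrU ?_
    rw [Metric.mem_ball] at hx ⊢
    rw [Metric.mem_closedBall] at hy
    linarith [dist_triangle y x a]
  refine (hasDerivAt_integral_of_dominated_loc_of_deriv_le (bound := fun u ↦ g u / (r / 3))
    (F' := fun x u ↦ deriv (F · u) x)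
    (Metric.ball_mem_nhds a (half_pos hr)) ?_ ?_ ?_ (.of_forall fun u x hx ↦ ?_)
    (hg.div_const _) (.of_forall fun u x hx ↦ ?_)).2.differentiableAt.differentiableWithinAt
  · filter_upwards [hU.mem_nhds ha] with x hx using hm x hx
  · exact hg.mono' (hm a ha) (.of_forall (hb a ha))
  -- The derivative is measurable in u as a limit of difference quotients; the steps r / (n + 2) are
  -- less than r already at n = 0.
  · have hs : Filter.Tendsto (fun n : ℕ ↦ ((r / (n + 2) : ℝ) : ℂ)) Filter.atTop
        (nhdsWithin 0 {0}ᶜ) := by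
      refine tendsto_nhdsWithin_iff.2 ⟨?_, .of_forall fun n ↦ ?_⟩
      · rw [← ofReal_zero]
        refine (continuous_ofReal.tendsto 0).comp ?_
        exact tendsto_const_nhds.div_atTop
          (Filter.tendsto_atTop_add_const_right _ _ tendsto_natCast_atTop_atTop)
      · have : (0 : ℝ) < r / (n + 2) := by positivity
        simpa using ofReal_ne_zero.2 this.ne'
    refine aestronglyMeasurable_of_tendsto_ae Filter.atTop
      (f := fun (n : ℕ) u ↦ ((r / (n + 2) : ℝ) : ℂ)⁻¹ • (F (a + (r / (n + 2) : ℝ)) u - F a u))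
      (fun n ↦ ?_) (.of_forall fun u ↦ (hderiv u a ha).tendsto_slope_zero.comp hs)
    change AEStronglyMeasurable (((r / (n + 2) : ℝ) : ℂ)⁻¹ • (F (a + (r / (n + 2) : ℝ)) - F a)) μ
    refine ((hm _ (hrU ?_)).sub (hm a ha)).const_smul _
    rw [Metric.mem_ball, dist_eq_norm, add_sub_cancel_left, norm_real,
      Real.norm_of_nonneg (by positivity), div_lt_iff₀ (by positivity)]
    nlinarith [mul_nonneg hr.le n.cast_nonneg]
  · refine norm_deriv_le_of_forall_mem_sphere_norm_le (by positivity) ?_ fun z hz ↦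
      hb z (hsub x hx (Metric.sphere_subset_closedBall hz)) u
    refine DifferentiableOn.diffContOnCl ((hd u).mono ?_)
    exact (Metric.closure_ball_subset_closedBall).trans (hsub x hx)
  · exact hderiv u x (hsub x hx (Metric.mem_closedBall_self (by positivity)))

/-! ### Periodic functions of polynomial growth. -/

/-- An entire function with period `1` and of polynomial growth in the imaginary direction is
constant. -/
theorem apply_eq_apply_of_periodic_of_norm_le {F : ℂ → ℂ} (hF : Differentiable ℂ F)
    (hper : ∀ z, F (z + 1) = F z) {C : ℝ} {k : ℕ} (hb : ∀ z, ‖F z‖ ≤ C * (1 + |z.im|) ^ k)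
    (z w : ℂ) : F z = F w := by
  revert z w
  -- The Cauchy estimate with radius 1 + |Im z| lowers the degree by one for F', which is again
  -- periodic. By induction F' is constant, so F is affine, and periodicity kills the slope. The
  -- case k = 0 is Liouville's theorem.
  induction k generalizing F C with
  | zero =>
    refine hF.apply_eq_apply_of_bounded ?_
    exact isBounded_iff_forall_norm_le.2 ⟨C, by rintro _ ⟨z, rfl⟩; simpa using hb z⟩
  | succ k ih =>
    have hC : 0 ≤ C := by simpa using (norm_nonneg _).trans (hb 0)
    have hper' : ∀ z, deriv F (z + 1) = deriv F z := fun z ↦ by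
      rw [← deriv_comp_add_const]; simp_rw [hper]
    have hb' : ∀ z, ‖deriv F z‖ ≤ C * 2 ^ (k + 1) * (1 + |z.im|) ^ k := fun z ↦ by
      have hR : 0 < 1 + |z.im| := by positivity
      have := norm_deriv_le_of_forall_mem_sphere_norm_le (f := F) (c := z) (R := 1 + |z.im|)
        (C := C * (2 * (1 + |z.im|)) ^ (k + 1)) hR hF.diffContOnCl fun w hw ↦ by
          refine (hb w).trans ?_
          have h1 : |w.im| ≤ |z.im| + (1 + |z.im|) := by
            have h2 := abs_im_le_norm (w - z)
            rw [mem_sphere_iff_norm.1 hw, sub_im] at h2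
            have := abs_sub_abs_le_abs_sub w.im z.im
            linarith
          gcongr
          linarith
      refine this.trans (le_of_eq ?_)
      rw [mul_pow, pow_succ (1 + |z.im|)]
      field_simp
    have hconst : ∀ z w, deriv F z = deriv F w := ih hF.deriv hper' hb'
    have hlin : ∀ z, F z = deriv F 0 * z + F 0 := fun z ↦ by
      have hd : Differentiable ℂ fun z ↦ F z - deriv F 0 * z := by fun_prop
      have := is_const_of_deriv_eq_zero hd (fun x ↦ by
        rw [deriv_fun_sub hF.differentiableAt (by fun_prop), deriv_const_mul_field']
        simp [hconst x 0]) z 0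
      simp at this
      linear_combination this
    intro z w
    have h1 := hper 0
    rw [hlin (0 + 1)] at h1
    have h0 : deriv F 0 = 0 := by simpa using h1
    rw [hlin z, hlin w, h0]; ring

/-- A version on a right half plane, where the periodicity supplies the continuation. -/
theorem apply_eq_apply_of_periodic_of_differentiableOn_re_pos {F : ℂ → ℂ}
    (hF : DifferentiableOn ℂ F {z | 0 < z.re}) (hper : ∀ z : ℂ, 0 < z.re → F (z + 1) = F z)
    {C : ℝ} {k : ℕ} (hb : ∀ z : ℂ, 1 ≤ z.re → z.re ≤ 2 → ‖F z‖ ≤ C * (1 + |z.im|) ^ k)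
    {z w : ℂ} (hz : 0 < z.re) (hw : 0 < w.re) : F z = F w := by
  have hnat : ∀ (n : ℕ) (z : ℂ), 0 < z.re → F (z + n) = F z := fun n z hz ↦ by
    induction n with
    | zero => simp
    | succ n ih =>
      rw [Nat.cast_succ, ← add_assoc, hper _ (by simpa using by positivity), ih]
  have hnat' : ∀ (m n : ℕ) (z : ℂ), 0 < z.re + m → 0 < z.re + n → F (z + m) = F (z + n) :=
    fun m n z hm hn ↦ by
      rw [← hnat n (z + m) (by simpa using hm), ← hnat m (z + n) (by simpa using hn)]
      ring_nf
  -- G is the entire continuation of F: translate by an integer large enough to reach the half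
  -- plane; periodicity makes the choice irrelevant.
  set G : ℂ → ℂ := fun z ↦ F (z + (⌊-z.re⌋₊ + 1 : ℕ)) with hG
  have hpos : ∀ z : ℂ, 0 < z.re + (⌊-z.re⌋₊ + 1 : ℕ) := fun z ↦ by
    push_cast; linarith [Nat.lt_floor_add_one (-z.re)]
  have hGF : ∀ (n : ℕ) (z : ℂ), 0 < z.re + n → G z = F (z + n) := fun n z hn ↦
    hnat' _ _ _ (hpos z) hn
  have hGd : Differentiable ℂ G := fun z ↦ by
    set n := ⌊-z.re⌋₊ + 1
    have hopen : IsOpen {w : ℂ | 0 < w.re + n} :=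
      isOpen_lt continuous_const (continuous_re.add continuous_const)
    have h1 : G =ᶠ[nhds z] fun w ↦ F (w + n) := by
      filter_upwards [hopen.mem_nhds (hpos z)] with w hw using hGF n w hw
    refine h1.differentiableAt_iff.2 ?_
    refine DifferentiableAt.comp (g := F) z ?_ (by fun_prop)
    exact hF.differentiableAt ((isOpen_lt continuous_const continuous_re).mem_nhds
      (by simpa only [Set.mem_ofPred_eq, add_re, natCast_re] using hpos z))
  have hGper : ∀ z, G (z + 1) = G z := fun z ↦ by
    set n := ⌊-z.re⌋₊ + 1
    have hn := hpos z
    rw [hGF n (z + 1) (by simp only [add_re, one_re]; linarith),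
      hGF (n + 1) z (by push_cast; linarith)]
    push_cast; ring_nf
  have hGb : ∀ z, ‖G z‖ ≤ C * (1 + |z.im|) ^ k := fun z ↦ by
    have hint : ∀ m : ℤ, G (z + m) = G z := fun m ↦ by
      have : Function.Periodic G 1 := hGper
      simpa using this.int_mul m z
    -- This translation brings the real part into [1, 2), where the growth of F is controlled.
    rw [← hint (1 - ⌊z.re⌋)]
    set y := z + ((1 - ⌊z.re⌋ : ℤ) : ℂ) with hy
    have hyre : y.re = z.re + (1 - ⌊z.re⌋) := by simp [hy]
    have hyim : y.im = z.im := by simp [hy]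
    have h1 := Int.floor_le z.re
    have h2 := Int.lt_floor_add_one z.re
    rw [hGF 0 y (by rw [hyre]; push_cast; linarith), ← hyim]
    simpa using hb y (by linarith) (by linarith)
  have key := apply_eq_apply_of_periodic_of_norm_le hGd hGper hGb z w
  rwa [hGF 0 z (by simpa), hGF 0 w (by simpa), Nat.cast_zero, add_zero, add_zero] at key

/-! ### Beta integrals in the logistic coordinate and Barnes' first lemma. -/

/-- The integrand `x ^ a * (1 - x) ^ c` of the Beta integral, with respect to `dx / (x * (1 - x))`,
in the logistic coordinate `x = 1 / (1 + exp (-v))`. -/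
noncomputable def logisticBeta (a c : ℂ) (v : ℝ) : ℂ :=
  exp (-a * (Real.log (1 + Real.exp (-v)) : ℝ) - c * (Real.log (1 + Real.exp v) : ℝ))

theorem continuous_logisticBeta (a c : ℂ) : Continuous (logisticBeta a c) := by
  have h1 : Continuous fun v : ℝ ↦ Real.log (1 + Real.exp (-v)) :=
    Continuous.log (by fun_prop) fun v ↦ by positivity
  have h2 : Continuous fun v : ℝ ↦ Real.log (1 + Real.exp v) :=
    Continuous.log (by fun_prop) fun v ↦ by positivity
  unfold logisticBeta
  fun_prop

theorem logisticBeta_neg (a c : ℂ) (v : ℝ) : logisticBeta a c (-v) = logisticBeta c a v := by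
  simp only [logisticBeta, neg_neg]; ring_nf

theorem logisticBeta_mul (a b c d : ℂ) (v : ℝ) :
    logisticBeta a c v * logisticBeta b d v = logisticBeta (a + b) (c + d) v := by
  simp only [logisticBeta, ← exp_add]; ring_nf

/-- In the logistic coordinate exp v = x / (1 - x), so an exponential twist only moves the two
parameters. Fourier transforms therefore stay within the family. -/
theorem exp_mul_logisticBeta (a c s : ℂ) (v : ℝ) :
    exp (s * v) * logisticBeta a c v = logisticBeta (a + s) (c - s) v := by
  have h : (v : ℂ) = (Real.log (1 + Real.exp v) : ℝ) - (Real.log (1 + Real.exp (-v)) : ℝ) := by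
    rw [← ofReal_sub, ← Real.log_div (by positivity) (by positivity)]
    congr 1
    rw [Real.exp_neg, show (1 + Real.exp v) / (1 + (Real.exp v)⁻¹) = Real.exp v by field_simp; ring,
      Real.log_exp]
  simp only [logisticBeta]
  conv_lhs => rw [h]
  rw [← exp_add]
  ring_nf

/-- The derivative of the sigmoid is x(1 - x), which accounts for the exponents a - 1 and c - 1 of
the usual Beta integrand. -/
theorem logisticBeta_eq_sigmoid (a c : ℂ) (v : ℝ) : logisticBeta a c v =
    |Real.sigmoid v * (1 - Real.sigmoid v)| •
      ((Real.sigmoid v : ℂ) ^ (a - 1) * (1 - (Real.sigmoid v : ℂ)) ^ (c - 1)) := by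
  have h0 := Real.sigmoid_pos v
  have h1 : 0 < 1 - Real.sigmoid v := by linarith [Real.sigmoid_lt_one v]
  have e0 : Real.log (Real.sigmoid v) = -Real.log (1 + Real.exp (-v)) := by
    rw [Real.sigmoid_def, Real.log_inv]
  have e1 : Real.log (1 - Real.sigmoid v) = -Real.log (1 + Real.exp v) := by
    rw [← Real.sigmoid_neg, Real.sigmoid_def, Real.log_inv, neg_neg]
  have c0 : (Real.sigmoid v : ℂ) ≠ 0 := ofReal_ne_zero.2 h0.ne'
  have c1 : ((1 - Real.sigmoid v : ℝ) : ℂ) ≠ 0 := ofReal_ne_zero.2 h1.ne'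
  rw [show (1 - (Real.sigmoid v : ℂ)) = ((1 - Real.sigmoid v : ℝ) : ℂ) by push_cast; rfl,
    abs_of_pos (mul_pos h0 h1), real_smul, ofReal_mul,
    cpow_sub _ _ c0, cpow_sub _ _ c1, cpow_one, cpow_one,
    cpow_def_of_ne_zero c0, cpow_def_of_ne_zero c1, ← ofReal_log h0.le, ← ofReal_log h1.le, e0, e1]
  field_simp
  rw [logisticBeta, ← exp_add]
  push_cast
  ring_nf

theorem integrable_logisticBeta {a c : ℂ} (ha : 0 < a.re) (hc : 0 < c.re) :
    Integrable (logisticBeta a c) := by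
  have h := betaIntegral_convergent ha hc
  rw [intervalIntegrable_iff_integrableOn_Ioo_of_le zero_le_one, ← Real.range_sigmoid,
    ← Set.image_univ, integrableOn_image_iff_integrableOn_abs_deriv_smul MeasurableSet.univ
      (fun x _ ↦ (Real.hasDerivAt_sigmoid x).hasDerivWithinAt) Real.sigmoid_injective.injOn,
    integrableOn_univ] at h
  exact h.congr (.of_forall fun v ↦ (logisticBeta_eq_sigmoid a c v).symm)

theorem integral_logisticBeta {a c : ℂ} (ha : 0 < a.re) (hc : 0 < c.re) :
    ∫ v, logisticBeta a c v = Gamma a * Gamma c / Gamma (a + c) := by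
  rw [← betaIntegral_eq_Gamma_mul_div a c ha hc, betaIntegral,
    intervalIntegral.integral_of_le zero_le_one, integral_Ioc_eq_integral_Ioo,
    ← Real.range_sigmoid, ← Set.image_univ, integral_image_eq_integral_abs_deriv_smul
      MeasurableSet.univ (fun x _ ↦ (Real.hasDerivAt_sigmoid x).hasDerivWithinAt)
      Real.sigmoid_injective.injOn, setIntegral_univ]
  exact integral_congr_ae (.of_forall fun v ↦ logisticBeta_eq_sigmoid a c v)

open FourierTransform in
theorem fourier_logisticBeta {a c : ℂ} (ha : 0 < a.re) (hc : 0 < c.re) (ξ : ℝ) :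
    𝓕 (logisticBeta a c) ξ = Gamma (a - I * (2 * Real.pi * ξ : ℝ)) *
      Gamma (c + I * (2 * Real.pi * ξ : ℝ)) / Gamma (a + c) := by
  rw [Real.fourier_real_eq_integral_exp_smul]
  have h : ∀ v : ℝ, exp (↑(-2 * Real.pi * v * ξ) * I) • logisticBeta a c v
      = logisticBeta (a - I * (2 * Real.pi * ξ : ℝ)) (c + I * (2 * Real.pi * ξ : ℝ)) v := fun v ↦ by
    have := exp_mul_logisticBeta a c (-(I * (2 * Real.pi * ξ : ℝ))) v
    rw [← sub_eq_add_neg, sub_neg_eq_add] at this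
    rw [← this, smul_eq_mul]
    congr 2; push_cast; ring
  simp_rw [h]
  rw [integral_logisticBeta (by simpa using ha) (by simpa using hc)]
  ring_nf

theorem differentiableAt_Gamma_of_re_pos {z : ℂ} (hz : 0 < z.re) : DifferentiableAt ℂ Gamma z :=
  differentiableAt_Gamma z fun m h ↦ by
    have h2 : (0 : ℝ) ≤ m := m.cast_nonneg
    rw [h] at hz
    simp at hz
    linarith

theorem Continuous.Gamma_of_re_pos {X : Type*} [TopologicalSpace X] {f : X → ℂ}
    (hf : Continuous f) (h : ∀ x, 0 < (f x).re) : Continuous fun x ↦ Gamma (f x) :=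
  continuous_iff_continuousAt.2 fun x ↦
    (differentiableAt_Gamma_of_re_pos (h x)).continuousAt.comp (f := f) hf.continuousAt

/-- **Barnes' first lemma**. -/
theorem integral_barnes_first {a b c d : ℂ} (ha : 0 < a.re) (hb : 0 < b.re) (hc : 0 < c.re)
    (hd : 0 < d.re) :
    ∫ s : ℝ, Gamma (a + I * s) * Gamma (b + I * s) * Gamma (c - I * s) * Gamma (d - I * s)
      = 2 * Real.pi * (Gamma (a + c) * Gamma (a + d) * Gamma (b + c) * Gamma (b + d)
        / Gamma (a + b + c + d)) := by
  have hac : Gamma (a + c) ≠ 0 := Gamma_ne_zero_of_re_pos (by simpa using add_pos ha hc)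
  have hbd : Gamma (b + d) ≠ 0 := Gamma_ne_zero_of_re_pos (by simpa using add_pos hb hd)
  have hint : Integrable (FourierTransform.fourier (logisticBeta d b) : ℝ → ℂ) := by
    obtain ⟨C, hC, h⟩ := exists_norm_Gamma_sub_I_mul_le hd
    obtain ⟨D, hD, h'⟩ := exists_norm_Gamma_add_I_mul_le hb
    refine Integrable.congr (f := fun ξ : ℝ ↦ Gamma (d - I * (2 * Real.pi * ξ : ℝ)) *
      Gamma (b + I * (2 * Real.pi * ξ : ℝ)) / Gamma (d + b)) ?_
      (.of_forall fun ξ ↦ (fourier_logisticBeta hd hb ξ).symm)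
    refine Integrable.comp_mul_left' (g := fun s : ℝ ↦ Gamma (d - I * s) *
      Gamma (b + I * s) / Gamma (d + b)) (Integrable.div_const ?_ _) (by positivity)
    refine ((Real.integrable_exp_neg_mul_abs three_pos).const_mul (C * D)).mono' ?_
      (.of_forall fun s ↦ ?_)
    · refine (Continuous.mul ?_ ?_).aestronglyMeasurable
      · exact Continuous.Gamma_of_re_pos (by fun_prop) (by simpa using hd)
      · exact Continuous.Gamma_of_re_pos (by fun_prop) (by simpa using hb)
    · rw [norm_mul]
      calc _ ≤ (C * Real.exp (-(3 / 2 * |s|))) * (D * Real.exp (-(3 / 2 * |s|))) :=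
            mul_le_mul (h s) (h' s) (norm_nonneg _) (by positivity)
        _ = _ := by rw [mul_mul_mul_comm, ← Real.exp_add]; ring_nf
  -- Two Fourier transforms reflect v, and reflection swaps the parameters.
  have hinv : (FourierTransform.fourier (FourierTransform.fourier (logisticBeta d b)) : ℝ → ℂ)
      = logisticBeta b d := by
    ext v
    have h1 := congrFun ((continuous_logisticBeta d b).fourierInv_fourier_eq
      (integrable_logisticBeta hd hb) hint) (-v)
    rwa [Real.fourierInv_eq_fourier_neg, neg_neg, logisticBeta_neg] at h1
  -- The left side is the Barnes integral up to normalization and the scaling s = 2πξ. On the right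
  -- the product of two Beta densities is a Beta density with parameters c + b and a + d.
  have key : ∫ ξ : ℝ, FourierTransform.fourier (logisticBeta c a) ξ •
        FourierTransform.fourier (logisticBeta d b) ξ
      = ∫ v : ℝ, logisticBeta c a v •
        FourierTransform.fourier (FourierTransform.fourier (logisticBeta d b) : ℝ → ℂ) v := by
    simpa using! VectorFourier.integral_fourierIntegral_smul_eq_flip (L := innerₗ ℝ)
      Real.continuous_fourierChar continuous_inner (integrable_logisticBeta hc ha) hint
  rw [hinv] at key
  simp_rw [smul_eq_mul, logisticBeta_mul, fourier_logisticBeta hc ha, fourier_logisticBeta hd hb]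
    at key
  rw [integral_logisticBeta (by simpa using add_pos hc hb) (by simpa using add_pos ha hd)] at key
  have hsub := Measure.integral_comp_mul_left (fun s : ℝ ↦
    Gamma (c - I * s) * Gamma (a + I * s) / Gamma (c + a) *
      (Gamma (d - I * s) * Gamma (b + I * s) / Gamma (d + b))) (2 * Real.pi)
  rw [hsub, abs_of_pos (by positivity), real_smul] at key
  have h3 : ∫ s : ℝ, Gamma (a + I * s) * Gamma (b + I * s) * Gamma (c - I * s) * Gamma (d - I * s)
      = Gamma (a + c) * Gamma (b + d) * ∫ s : ℝ, Gamma (c - I * s) * Gamma (a + I * s) /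
        Gamma (c + a) * (Gamma (d - I * s) * Gamma (b + I * s) / Gamma (d + b)) := by
    rw [← integral_const_mul]
    congr 1; ext s
    rw [add_comm c a, add_comm d b]
    field_simp
  have hpi : (Real.pi : ℂ) ≠ 0 := ofReal_ne_zero.2 Real.pi_ne_zero
  push_cast at key
  rw [h3, show a + b + c + d = c + b + (a + d) by ring]
  rw [inv_mul_eq_iff_eq_mul₀ (by simp)] at key
  rw [key, add_comm b c]
  ring

/-! ### The de Branges–Wilson integral: weight and recurrence. -/

theorem norm_sin_le_exp_abs_im (z : ℂ) : ‖sin z‖ ≤ Real.exp |z.im| := by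
  rw [Complex.sin, norm_div, norm_mul, norm_I, mul_one, Complex.norm_two, div_le_iff₀ two_pos]
  refine (norm_sub_le _ _).trans ?_
  rw [norm_exp, norm_exp]
  have h1 : (-z * I).re = z.im := by simp
  have h2 : (z * I).re = -z.im := by simp
  rw [h1, h2, mul_two]
  exact add_le_add (Real.exp_le_exp.2 (le_abs_self _)) (Real.exp_le_exp.2 (neg_le_abs _))

/-- The product `Γ(a + iw) Γ(a - iw)`. -/
noncomputable def gammaPair (a w : ℂ) : ℂ := Gamma (a + I * w) * Gamma (a - I * w)

theorem exists_norm_gammaPair_le {a : ℂ} (ha : 0 < a.re) : ∃ C : ℝ, 0 < C ∧ ∀ u : ℝ,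
    ‖gammaPair a u‖ ≤ C * Real.exp (-(3 * |u|)) := by
  obtain ⟨C, hC, h⟩ := exists_norm_Gamma_add_I_mul_le ha
  obtain ⟨D, hD, h'⟩ := exists_norm_Gamma_sub_I_mul_le ha
  refine ⟨C * D, by positivity, fun u ↦ ?_⟩
  rw [gammaPair, norm_mul]
  calc _ ≤ (C * Real.exp (-(3 / 2 * |u|))) * (D * Real.exp (-(3 / 2 * |u|))) :=
        mul_le_mul (h u) (h' u) (norm_nonneg _) (by positivity)
    _ = _ := by rw [mul_mul_mul_comm, ← Real.exp_add]; ring_nf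

theorem continuous_gammaPair {a : ℂ} (ha : 0 < a.re) : Continuous fun u : ℝ ↦ gammaPair a u :=
  (Continuous.Gamma_of_re_pos (by fun_prop) (by simpa using ha)).mul
    (Continuous.Gamma_of_re_pos (by fun_prop) (by simpa using ha))

theorem gammaPair_add_one {a : ℂ} (ha : 0 < a.re) (u : ℝ) :
    gammaPair (a + 1) u = (a ^ 2 + u ^ 2) * gammaPair a u := by
  have h1 : a + I * u ≠ 0 := fun h ↦ by simpa [ha.ne'] using congrArg re h
  have h2 : a - I * u ≠ 0 := fun h ↦ by simpa [ha.ne'] using congrArg re h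
  rw [gammaPair, gammaPair, show a + 1 + I * u = a + I * u + 1 by ring,
    show a + 1 - I * u = a - I * u + 1 by ring, Gamma_add_one _ h1, Gamma_add_one _ h2]
  linear_combination -(u ^ 2 * Gamma (a + I * u) * Gamma (a - I * u)) * I_sq

/-- The de Branges-Wilson weight with one of its four parameters removed. -/
noncomputable def wilsonWeight (b c d : ℂ) (u : ℝ) : ℂ :=
  gammaPair b u * gammaPair c u * gammaPair d u *
    (Gamma (I * (2 * u : ℝ)) * Gamma (-(I * (2 * u : ℝ))))⁻¹

/-- Three pairs contribute exp(-9|u|), while the reciprocal Gamma functions, taken at 2u, cost at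
most exp(8|u|). -/
theorem exists_norm_wilsonWeight_le {b c d : ℂ} (hb : 0 < b.re) (hc : 0 < c.re) (hd : 0 < d.re) :
    ∃ C : ℝ, 0 < C ∧ ∀ u : ℝ, ‖wilsonWeight b c d u‖ ≤ C * Real.exp (-|u|) := by
  obtain ⟨B, hB, h1⟩ := exists_norm_gammaPair_le hb
  obtain ⟨C, hC, h2⟩ := exists_norm_gammaPair_le hc
  obtain ⟨D, hD, h3⟩ := exists_norm_gammaPair_le hd
  obtain ⟨K, hK, h4⟩ := exists_norm_inv_Gamma_mul_Gamma_neg_le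
  refine ⟨B * C * D * K, by positivity, fun u ↦ ?_⟩
  have h5 := h4 (2 * u)
  rw [abs_mul, abs_two, ← mul_assoc] at h5
  rw [wilsonWeight, norm_mul, norm_mul, norm_mul]
  calc _ ≤ (B * Real.exp (-(3 * |u|))) * (C * Real.exp (-(3 * |u|))) *
        (D * Real.exp (-(3 * |u|))) * (K * Real.exp (4 * 2 * |u|)) := by
        gcongr
        exacts [h1 u, h2 u, h3 u]
    _ = B * C * D * K * (Real.exp (-(3 * |u|)) * Real.exp (-(3 * |u|)) * Real.exp (-(3 * |u|)) *
        Real.exp (4 * 2 * |u|)) := by ring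
    _ = _ := by simp only [← Real.exp_add]; ring_nf

theorem continuous_inv_Gamma_mul_Gamma_neg :
    Continuous fun z : ℂ ↦ (Gamma z * Gamma (-z))⁻¹ := by
  simp_rw [inv_Gamma_mul_Gamma_neg]
  fun_prop

theorem continuous_wilsonWeight {b c d : ℂ} (hb : 0 < b.re) (hc : 0 < c.re) (hd : 0 < d.re) :
    Continuous (wilsonWeight b c d) :=
  (((continuous_gammaPair hb).mul (continuous_gammaPair hc)).mul (continuous_gammaPair hd)).mul
    (continuous_inv_Gamma_mul_Gamma_neg.comp (f := fun u : ℝ ↦ I * (2 * u : ℝ)) (by fun_prop))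

/-- The integral of de Branges and Wilson. -/
noncomputable def wilsonIntegral (a b c d : ℂ) : ℂ :=
  ∫ u : ℝ, gammaPair a u * wilsonWeight b c d u

theorem integrable_gammaPair_mul_wilsonWeight {a b c d : ℂ} (ha : 0 < a.re) (hb : 0 < b.re)
    (hc : 0 < c.re) (hd : 0 < d.re) :
    Integrable fun u : ℝ ↦ gammaPair a u * wilsonWeight b c d u := by
  obtain ⟨A, hA, h1⟩ := exists_norm_gammaPair_le ha
  obtain ⟨C, hC, h2⟩ := exists_norm_wilsonWeight_le hb hc hd
  refine ((Real.integrable_exp_neg_mul_abs four_pos).const_mul (A * C)).mono'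
    ((continuous_gammaPair ha).mul (continuous_wilsonWeight hb hc hd)).aestronglyMeasurable
    (.of_forall fun u ↦ ?_)
  rw [norm_mul]
  calc _ ≤ (A * Real.exp (-(3 * |u|))) * (C * Real.exp (-|u|)) :=
        mul_le_mul (h1 u) (h2 u) (norm_nonneg _) (by positivity)
    _ = _ := by rw [mul_mul_mul_comm, ← Real.exp_add]; ring_nf

/-- Rotation brings each parameter in turn to the first place, the only one that is varied
analytically. -/
theorem wilsonIntegral_rotate (a b c d : ℂ) :
    wilsonIntegral a b c d = wilsonIntegral b c d a := by
  simp only [wilsonIntegral, wilsonWeight]; congr 1; ext u; ring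

/-- For |Im w| ≤ 1/2 the arguments a + 1/2 ± iw have real parts in [Re a, Re a + 1], so the whole
strip avoids the poles. -/
theorem exists_norm_gammaPair_add_one_half_le {a : ℂ} (ha : 0 < a.re) :
    ∃ C : ℝ, 0 < C ∧ ∀ w : ℂ, |w.im| ≤ 1 / 2 →
      ‖gammaPair (a + 1 / 2) w‖ ≤ C * Real.exp (-(3 * |w.re|)) := by
  obtain ⟨C, hC, h⟩ := exists_norm_Gamma_le_exp ha (a.re + 1)
  refine ⟨C ^ 2 * Real.exp (3 * |a.im|), by positivity, fun w hw ↦ ?_⟩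
  rw [abs_le] at hw
  have e1 : (a + 1 / 2 + I * w).im = a.im + w.re := by simp
  have e2 : (a + 1 / 2 - I * w).im = a.im - w.re := by simp
  have e3 : (a + 1 / 2 + I * w).re = a.re + 1 / 2 - w.im := by simp; ring
  have e4 : (a + 1 / 2 - I * w).re = a.re + 1 / 2 + w.im := by simp
  have h1 := h (a + 1 / 2 + I * w) (by rw [e3]; linarith) (by rw [e3]; linarith)
  have h2 := h (a + 1 / 2 - I * w) (by rw [e4]; linarith) (by rw [e4]; linarith)
  rw [e1] at h1
  rw [e2] at h2
  rw [gammaPair, norm_mul]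
  have h3 : 2 * |w.re| - 2 * |a.im| ≤ |a.im + w.re| + |a.im - w.re| := by
    have := abs_add_le (a.im + w.re) (-(a.im - w.re))
    rw [abs_neg, show a.im + w.re + -(a.im - w.re) = 2 * w.re by ring, abs_mul, abs_two] at this
    linarith [abs_nonneg a.im]
  calc _ ≤ (C * Real.exp (-(3 / 2 * |a.im + w.re|))) * (C * Real.exp (-(3 / 2 * |a.im - w.re|))) :=
        mul_le_mul h1 h2 (norm_nonneg _) (by positivity)
    _ = C ^ 2 * Real.exp (-(3 / 2 * |a.im + w.re|) + -(3 / 2 * |a.im - w.re|)) := by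
        rw [mul_mul_mul_comm, ← Real.exp_add]; ring
    _ ≤ C ^ 2 * Real.exp (3 * |a.im| + -(3 * |w.re|)) :=
        mul_le_mul_of_nonneg_left (Real.exp_le_exp.2 (by linarith)) (by positivity)
    _ = _ := by rw [Real.exp_add]; ring

theorem differentiableAt_gammaPair_add_one_half {a w : ℂ} (ha : 0 < a.re) (hw : |w.im| ≤ 1 / 2) :
    DifferentiableAt ℂ (gammaPair (a + 1 / 2)) w := by
  rw [abs_le] at hw
  refine DifferentiableAt.mul ?_ ?_
  · refine DifferentiableAt.comp (g := Gamma) w (differentiableAt_Gamma_of_re_pos ?_) (by fun_prop)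
    simp; linarith
  · refine DifferentiableAt.comp (g := Gamma) w (differentiableAt_Gamma_of_re_pos ?_) (by fun_prop)
    simp; linarith

theorem gammaPair_add_one_half_sub {a : ℂ} (ha : 0 < a.re) (u : ℝ) :
    gammaPair (a + 1 / 2) (u + (-(1 / 2) : ℝ) * I) = (a + I * u) * gammaPair a u := by
  have h1 : a + I * u ≠ 0 := fun h ↦ by simpa [ha.ne'] using congrArg re h
  rw [gammaPair, gammaPair, ← mul_assoc, ← Gamma_add_one _ h1]
  congr 2
  · push_cast; linear_combination (-(1 / 2) : ℂ) * I_sq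
  · push_cast; linear_combination (1 / 2 : ℂ) * I_sq

theorem gammaPair_add_one_half_add {a : ℂ} (ha : 0 < a.re) (u : ℝ) :
    gammaPair (a + 1 / 2) (u + (1 / 2 : ℝ) * I) = (a - I * u) * gammaPair a u := by
  have h1 : a - I * u ≠ 0 := fun h ↦ by simpa [ha.ne'] using congrArg re h
  rw [gammaPair, gammaPair, mul_left_comm, ← Gamma_add_one _ h1]
  congr 2
  · push_cast; linear_combination (1 / 2 : ℂ) * I_sq
  · push_cast; linear_combination (-(1 / 2) : ℂ) * I_sq

/-- The difference of the two integrands is a constant times g(u - i/2) - g(u + i/2) with g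
holomorphic in the strip, so a contour shift makes it integrate to 0. With z = iu and elementary
symmetric functions e₁, e₃ of a, b, c, d, this rests on ∏(a + z) - ∏(a - z) = 2z(e₁z² + e₃), the
products over the four parameters, and on e₁(a² - z²) - (a + b)(a + c)(a + d) = -(e₁z² + e₃). -/
theorem wilsonIntegral_add_one {a b c d : ℂ} (ha : 0 < a.re) (hb : 0 < b.re) (hc : 0 < c.re)
    (hd : 0 < d.re) : (a + b + c + d) * wilsonIntegral (a + 1) b c d =
      (a + b) * (a + c) * (a + d) * wilsonIntegral a b c d := by
  obtain ⟨A, hA, h1⟩ := exists_norm_gammaPair_add_one_half_le ha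
  obtain ⟨B, hB, h2⟩ := exists_norm_gammaPair_add_one_half_le hb
  obtain ⟨C, hC, h3⟩ := exists_norm_gammaPair_add_one_half_le hc
  obtain ⟨D, hD, h4⟩ := exists_norm_gammaPair_add_one_half_le hd
  set g : ℂ → ℂ := fun w ↦ sin (2 * Real.pi * (I * w)) * gammaPair (a + 1 / 2) w *
    gammaPair (b + 1 / 2) w * gammaPair (c + 1 / 2) w * gammaPair (d + 1 / 2) w with hg
  have hgd : ∀ w : ℂ, |w.im| ≤ 1 / 2 → DifferentiableAt ℂ g w := fun w hw ↦
    ((((by fun_prop : DifferentiableAt ℂ (fun w ↦ sin (2 * Real.pi * (I * w))) w).mul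
      (differentiableAt_gammaPair_add_one_half ha hw)).mul
      (differentiableAt_gammaPair_add_one_half hb hw)).mul
      (differentiableAt_gammaPair_add_one_half hc hw)).mul
      (differentiableAt_gammaPair_add_one_half hd hw)
  have hgb : ∀ w : ℂ, |w.im| ≤ 1 / 2 → ‖g w‖ ≤ A * B * C * D * Real.exp (-(4 * |w.re|)) :=
      fun w hw ↦ by
    have h5 : ‖sin (2 * Real.pi * (I * w))‖ ≤ Real.exp (8 * |w.re|) := by
      refine (norm_sin_le_exp_abs_im _).trans (Real.exp_le_exp.2 ?_)
      have : (2 * Real.pi * (I * w)).im = 2 * Real.pi * w.re := by simp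
      rw [this, abs_mul, abs_of_pos (by positivity)]
      nlinarith [Real.pi_lt_four, abs_nonneg w.re]
    simp only [hg, norm_mul]
    calc _ ≤ Real.exp (8 * |w.re|) * (A * Real.exp (-(3 * |w.re|))) * (B * Real.exp (-(3 * |w.re|)))
          * (C * Real.exp (-(3 * |w.re|))) * (D * Real.exp (-(3 * |w.re|))) := by
          gcongr
          exacts [h1 w hw, h2 w hw, h3 w hw, h4 w hw]
      _ = A * B * C * D * (Real.exp (8 * |w.re|) * Real.exp (-(3 * |w.re|)) *
          Real.exp (-(3 * |w.re|)) * Real.exp (-(3 * |w.re|)) * Real.exp (-(3 * |w.re|))) := by ring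
      _ = _ := by simp only [← Real.exp_add]; ring_nf
  have hmem : ∀ w : ℂ, w.im ∈ Set.uIcc (-(1 / 2) : ℝ) (1 / 2) → |w.im| ≤ 1 / 2 := fun w hw ↦ by
    rw [Set.uIcc_of_le (by norm_num)] at hw
    exact abs_le.2 hw
  have hshift := integral_add_mul_I_eq_of_norm_le_exp four_pos (fun w hw ↦ hgd w (hmem w hw))
    (fun w hw ↦ hgb w (hmem w hw))
  have hi1 := integrable_add_mul_I_of_norm_le_exp (f := g) (y := -(1 / 2)) four_pos
    (fun w hw ↦ hgd w (by rw [hw]; norm_num)) (fun w hw ↦ hgb w (by rw [hw]; norm_num))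
  have hi2 := integrable_add_mul_I_of_norm_le_exp (f := g) (y := 1 / 2) four_pos
    (fun w hw ↦ hgd w (by rw [hw]; norm_num)) (fun w hw ↦ hgb w (by rw [hw]; norm_num))
  rw [← sub_eq_zero, ← integral_sub hi1 hi2] at hshift
  have hpt : ∀ u : ℝ, (a + b + c + d) * (gammaPair (a + 1) u * wilsonWeight b c d u) -
      (a + b) * (a + c) * (a + d) * (gammaPair a u * wilsonWeight b c d u) =
      -(Real.pi : ℂ)⁻¹ * (g (u + (-(1 / 2) : ℝ) * I) - g (u + (1 / 2 : ℝ) * I)) := fun u ↦ by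
    have s1 : sin (2 * Real.pi * (I * (u + (-(1 / 2) : ℝ) * I))) =
        -sin (2 * Real.pi * (I * u)) := by
      rw [← Complex.sin_add_pi]; congr 1; push_cast; linear_combination (-Real.pi : ℂ) * I_sq
    have s2 : sin (2 * Real.pi * (I * (u + (1 / 2 : ℝ) * I))) =
        -sin (2 * Real.pi * (I * u)) := by
      rw [← Complex.sin_sub_pi]; congr 1; push_cast; linear_combination (Real.pi : ℂ) * I_sq
    have hu : ((u : ℂ)) ^ 2 = -(I * u) ^ 2 := by rw [mul_pow, I_sq]; ring
    simp only [hg, s1, s2, gammaPair_add_one_half_sub ha, gammaPair_add_one_half_sub hb,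
      gammaPair_add_one_half_sub hc, gammaPair_add_one_half_sub hd, gammaPair_add_one_half_add ha,
      gammaPair_add_one_half_add hb, gammaPair_add_one_half_add hc, gammaPair_add_one_half_add hd,
      gammaPair_add_one ha, wilsonWeight, inv_Gamma_mul_Gamma_neg, hu]
    rw [show (Real.pi : ℂ) * (I * ((2 * u : ℝ) : ℂ)) = 2 * Real.pi * (I * u) by push_cast; ring,
      show I * ((2 * u : ℝ) : ℂ) = 2 * (I * u) by push_cast; ring]
    ring
  have h6 : (a + b + c + d) * wilsonIntegral (a + 1) b c d -
      (a + b) * (a + c) * (a + d) * wilsonIntegral a b c d = 0 := by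
    rw [wilsonIntegral, wilsonIntegral, ← integral_const_mul, ← integral_const_mul,
      ← integral_sub ((integrable_gammaPair_mul_wilsonWeight (by simp; positivity) hb hc
        hd).const_mul _) ((integrable_gammaPair_mul_wilsonWeight ha hb hc hd).const_mul _)]
    simp_rw [hpt]
    rw [integral_const_mul, hshift, mul_zero]
  exact sub_eq_zero.1 h6

/-! ### The de Branges–Wilson integral: dependence on the first parameter. -/

theorem one_add_abs_add_pow_le (x y : ℝ) (n : ℕ) :
    (1 + |x + y|) ^ n ≤ (1 + |x|) ^ n * (1 + |y|) ^ n := by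
  rw [← mul_pow]
  have := abs_add_le x y
  gcongr
  nlinarith [abs_nonneg x, abs_nonneg y]

theorem exists_norm_Gamma_add_le {b : ℂ} (hb : 0 ≤ b.re) : ∃ (C : ℝ) (n : ℕ), 0 < C ∧ ∀ a : ℂ,
    1 ≤ a.re → a.re ≤ 2 →
      ‖Gamma (a + b)‖ ≤ C * (1 + |a.im|) ^ n * Real.exp (-(Real.pi / 2 * |a.im|)) := by
  obtain ⟨C, n, hC, h⟩ := exists_norm_Gamma_le one_pos (2 + b.re)
  refine ⟨C * (1 + |b.im|) ^ n * Real.exp (Real.pi / 2 * |b.im|), n, by positivity,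
    fun a h1 h2 ↦ (h _ (by simp; linarith) (by simpa using h2)).trans ?_⟩
  rw [add_im]
  have h3 : |a.im| ≤ |a.im + b.im| + |b.im| := by
    simpa using abs_add_le (a.im + b.im) (-b.im)
  calc _ ≤ C * ((1 + |a.im|) ^ n * (1 + |b.im|) ^ n) *
        Real.exp (Real.pi / 2 * |b.im| + -(Real.pi / 2 * |a.im|)) := by
        refine mul_le_mul (mul_le_mul_of_nonneg_left (one_add_abs_add_pow_le _ _ _) hC.le)
          (Real.exp_le_exp.2 ?_) (Real.exp_pos _).le (by positivity)
        nlinarith [Real.pi_pos]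
    _ = _ := by rw [Real.exp_add]; ring

theorem exists_norm_Gamma_add_inv_le {b : ℂ} (hb : 0 ≤ b.re) : ∃ C : ℝ, 0 < C ∧ ∀ a : ℂ,
    1 ≤ a.re → a.re ≤ 2 → ‖(Gamma (a + b))⁻¹‖ ≤ C * Real.exp (Real.pi / 2 * |a.im|) := by
  obtain ⟨C, hC, h⟩ := exists_norm_Gamma_inv_le (2 + b.re)
  refine ⟨C * Real.exp (Real.pi / 2 * |b.im|), by positivity,
    fun a h1 h2 ↦ (h _ (by simp; linarith) (by simpa using h2)).trans ?_⟩
  rw [mul_assoc, ← Real.exp_add, add_im]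
  have h3 := abs_add_le a.im b.im
  refine mul_le_mul_of_nonneg_left (Real.exp_le_exp.2 ?_) hC.le
  nlinarith [Real.pi_pos]

/-- Since |Im a + u| + |Im a - u| ≥ 2|Im a|, the full rate π in Im a survives at the price of a
polynomial in u. A smaller rate would not do: it has to cancel the growth in
`exists_norm_inv_wilsonProduct_le`. -/
theorem exists_norm_gammaPair_le_one_add_pow : ∃ (C : ℝ) (n : ℕ), 0 < C ∧ ∀ (a : ℂ) (u : ℝ),
    1 ≤ a.re → a.re ≤ 2 →
      ‖gammaPair a u‖ ≤ C * (1 + |a.im|) ^ n * Real.exp (-(Real.pi * |a.im|)) * (1 + |u|) ^ n := by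
  obtain ⟨C, n, hC, h⟩ := exists_norm_Gamma_le one_pos 2
  refine ⟨C ^ 2, n + n, by positivity, fun a u h1 h2 ↦ ?_⟩
  have e1 : (a + I * u).im = a.im + u := by simp
  have e2 : (a - I * u).im = a.im - u := by simp
  have h3 := h (a + I * u) (by simpa using h1) (by simpa using h2)
  have h4 := h (a - I * u) (by simpa using h1) (by simpa using h2)
  rw [e1] at h3
  rw [e2] at h4
  have h5 : 2 * |a.im| ≤ |a.im + u| + |a.im - u| := by
    have := abs_add_le (a.im + u) (a.im - u)
    rwa [show a.im + u + (a.im - u) = 2 * a.im by ring, abs_mul, abs_two] at this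
  have h6 := one_add_abs_add_pow_le a.im u n
  have h7 := one_add_abs_add_pow_le a.im (-u) n
  rw [abs_neg, ← sub_eq_add_neg] at h7
  rw [gammaPair, norm_mul]
  calc _ ≤ (C * (1 + |a.im + u|) ^ n * Real.exp (-(Real.pi / 2 * |a.im + u|))) *
        (C * (1 + |a.im - u|) ^ n * Real.exp (-(Real.pi / 2 * |a.im - u|))) :=
        mul_le_mul h3 h4 (norm_nonneg _) (by positivity)
    _ = C ^ 2 * ((1 + |a.im + u|) ^ n * (1 + |a.im - u|) ^ n) *
        Real.exp (-(Real.pi / 2 * |a.im + u|) + -(Real.pi / 2 * |a.im - u|)) := by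
        rw [Real.exp_add]; ring
    _ ≤ C ^ 2 * (((1 + |a.im|) ^ n * (1 + |u|) ^ n) * ((1 + |a.im|) ^ n * (1 + |u|) ^ n)) *
        Real.exp (-(Real.pi * |a.im|)) := by
        refine mul_le_mul (mul_le_mul_of_nonneg_left (mul_le_mul h6 h7 ?_ ?_) ?_)
          (Real.exp_le_exp.2 ?_) (Real.exp_pos _).le ?_
        · positivity
        · positivity
        · positivity
        · nlinarith [Real.pi_pos]
        · positivity
    _ = _ := by rw [pow_add, pow_add]; ring

theorem exists_norm_wilsonIntegral_le {b c d : ℂ} (hb : 0 < b.re) (hc : 0 < c.re)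
    (hd : 0 < d.re) : ∃ (C : ℝ) (n : ℕ), 0 ≤ C ∧ ∀ a : ℂ, 1 ≤ a.re → a.re ≤ 2 →
      ‖wilsonIntegral a b c d‖ ≤ C * (1 + |a.im|) ^ n * Real.exp (-(Real.pi * |a.im|)) := by
  obtain ⟨C, n, hC, h1⟩ := exists_norm_gammaPair_le_one_add_pow
  obtain ⟨D, hD, h2⟩ := exists_norm_wilsonWeight_le hb hc hd
  obtain ⟨K, hK, h3⟩ := exists_one_add_pow_le_exp n one_half_pos
  refine ⟨C * (K * D) * ∫ u : ℝ, Real.exp (-(1 / 2 * |u|)), n,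
    mul_nonneg (by positivity) (integral_nonneg fun u ↦ (Real.exp_pos _).le), fun a ha1 ha2 ↦ ?_⟩
  have hint := Real.integrable_exp_neg_mul_abs one_half_pos
  refine (norm_integral_le_of_norm_le (hint.const_mul
    (C * (1 + |a.im|) ^ n * Real.exp (-(Real.pi * |a.im|)) * (K * D)))
    (.of_forall fun u ↦ ?_)).trans (le_of_eq ?_)
  · rw [norm_mul]
    calc _ ≤ (C * (1 + |a.im|) ^ n * Real.exp (-(Real.pi * |a.im|)) *
          (K * Real.exp (1 / 2 * |u|))) * (D * Real.exp (-|u|)) :=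
          mul_le_mul ((h1 a u ha1 ha2).trans (mul_le_mul_of_nonneg_left (h3 _ (abs_nonneg u))
            (by positivity))) (h2 u) (norm_nonneg _) (by positivity)
      _ = C * (1 + |a.im|) ^ n * Real.exp (-(Real.pi * |a.im|)) * (K * D) *
          (Real.exp (1 / 2 * |u|) * Real.exp (-|u|)) := by ring
      _ = _ := by rw [← Real.exp_add]; ring_nf
  · rw [integral_const_mul]; ring

theorem differentiableOn_wilsonIntegral {b c d : ℂ} (hb : 0 < b.re) (hc : 0 < c.re)
    (hd : 0 < d.re) : DifferentiableOn ℂ (fun a ↦ wilsonIntegral a b c d) {a | 0 < a.re} := by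
  intro a ha
  have ha : 0 < a.re := ha
  -- The maps z ↦ z ± iu preserve this vertical strip, so both Gamma factors are bounded by C
  -- uniformly in u.
  set U : Set ℂ := {z | a.re / 2 < z.re ∧ z.re < a.re + 1}
  have hU : IsOpen U := (isOpen_lt continuous_const continuous_re).inter
    (isOpen_lt continuous_re continuous_const)
  have hpos : ∀ z ∈ U, 0 < z.re := fun z hz ↦ (half_pos ha).trans hz.1
  obtain ⟨C, hC, h1⟩ := exists_norm_Gamma_le_exp (half_pos ha) (a.re + 1)
  obtain ⟨D, hD, h2⟩ := exists_norm_wilsonWeight_le hb hc hd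
  have hG : ∀ z : ℂ, z ∈ U → ‖Gamma z‖ ≤ C := fun z hz ↦
    (h1 z hz.1.le hz.2.le).trans (mul_le_of_le_one_right hC.le
      (Real.exp_le_one_iff.2 (by simp)))
  have hadd : ∀ z ∈ U, ∀ u : ℝ, z + I * u ∈ U := fun z hz u ↦ by simpa [U] using hz
  have hsub : ∀ z ∈ U, ∀ u : ℝ, z - I * u ∈ U := fun z hz u ↦ by simpa [U] using hz
  have key := differentiableOn_integral_of_norm_le (μ := volume) hU
    (F := fun z (u : ℝ) ↦ gammaPair z u * wilsonWeight b c d u)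
    (g := fun u ↦ C * C * (D * Real.exp (-(1 * |u|)))) (fun u z hz ↦ ?_) (fun z hz ↦ ?_)
    (fun z hz u ↦ ?_) (((Real.integrable_exp_neg_mul_abs one_pos).const_mul D).const_mul (C * C))
  · exact (key.differentiableAt (hU.mem_nhds ⟨by linarith, by linarith⟩)).differentiableWithinAt
  · refine (DifferentiableAt.mul (DifferentiableAt.mul ?_ ?_)
      (differentiableAt_const _)).differentiableWithinAt
    · exact DifferentiableAt.comp (g := Gamma) z
        (differentiableAt_Gamma_of_re_pos (hpos _ (hadd z hz u))) (by fun_prop)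
    · exact DifferentiableAt.comp (g := Gamma) z
        (differentiableAt_Gamma_of_re_pos (hpos _ (hsub z hz u))) (by fun_prop)
  · exact ((continuous_gammaPair (hpos z hz)).mul
      (continuous_wilsonWeight hb hc hd)).aestronglyMeasurable
  · rw [norm_mul, gammaPair, norm_mul, one_mul]
    exact mul_le_mul (mul_le_mul (hG _ (hadd z hz u)) (hG _ (hsub z hz u)) (norm_nonneg _) hC.le)
      (h2 u) (norm_nonneg _) (by positivity)

/-- The ratio of Gamma products that evaluates the integral of de Branges and Wilson. -/
noncomputable def wilsonProduct (a b c d : ℂ) : ℂ :=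
  Gamma (a + b) * Gamma (a + c) * Gamma (a + d) * Gamma (b + c) * Gamma (b + d) * Gamma (c + d) /
    Gamma (a + b + c + d)

theorem wilsonProduct_rotate (a b c d : ℂ) : wilsonProduct a b c d = wilsonProduct b c d a := by
  rw [wilsonProduct, wilsonProduct, add_comm b a, add_comm c a, add_comm d a,
    show b + c + d + a = a + b + c + d by ring]
  ring

theorem wilsonProduct_ne_zero {a b c d : ℂ} (ha : 0 < a.re) (hb : 0 < b.re) (hc : 0 < c.re)
    (hd : 0 < d.re) : wilsonProduct a b c d ≠ 0 := by
  have h : ∀ z : ℂ, 0 < z.re → Gamma z ≠ 0 := fun z hz ↦ Gamma_ne_zero_of_re_pos hz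
  rw [wilsonProduct]
  refine div_ne_zero (mul_ne_zero (mul_ne_zero (mul_ne_zero (mul_ne_zero (mul_ne_zero ?_ ?_) ?_) ?_)
    ?_) ?_) ?_ <;> refine h _ ?_ <;> simp <;> linarith

theorem wilsonProduct_add_one {a b c d : ℂ} (ha : 0 < a.re) (hb : 0 < b.re) (hc : 0 < c.re)
    (hd : 0 < d.re) : (a + b + c + d) * wilsonProduct (a + 1) b c d =
      (a + b) * (a + c) * (a + d) * wilsonProduct a b c d := by
  have h : ∀ z : ℂ, 0 < z.re → z ≠ 0 := fun z hz h ↦ by simp [h] at hz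
  have h4 : a + b + c + d ≠ 0 := h _ (by simp; linarith)
  rw [wilsonProduct, wilsonProduct, show a + 1 + b = a + b + 1 by ring,
    show a + 1 + c = a + c + 1 by ring, show a + 1 + d = a + d + 1 by ring,
    show a + b + 1 + c + d = a + b + c + d + 1 by ring,
    Gamma_add_one _ (h (a + b) (by simp; linarith)),
    Gamma_add_one _ (h (a + c) (by simp; linarith)),
    Gamma_add_one _ (h (a + d) (by simp; linarith)), Gamma_add_one _ h4]
  have h5 : Gamma (a + b + c + d) ≠ 0 := Gamma_ne_zero_of_re_pos (by simp; linarith)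
  field_simp

/-- Three reciprocal Gamma functions grow at rate π/2 each and Γ(a + b + c + d) decays at rate π/2,
which leaves exactly π. -/
theorem exists_norm_inv_wilsonProduct_le {b c d : ℂ} (hb : 0 < b.re) (hc : 0 < c.re)
    (hd : 0 < d.re) : ∃ (C : ℝ) (n : ℕ), 0 < C ∧ ∀ a : ℂ, 1 ≤ a.re → a.re ≤ 2 →
      ‖(wilsonProduct a b c d)⁻¹‖ ≤ C * (1 + |a.im|) ^ n * Real.exp (Real.pi * |a.im|) := by
  obtain ⟨B, hB, h1⟩ := exists_norm_Gamma_add_inv_le hb.le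
  obtain ⟨C, hC, h2⟩ := exists_norm_Gamma_add_inv_le hc.le
  obtain ⟨D, hD, h3⟩ := exists_norm_Gamma_add_inv_le hd.le
  obtain ⟨E, n, hE, h4⟩ := exists_norm_Gamma_add_le (b := b + c + d) (by simp; positivity)
  set K := ‖(Gamma (b + c) * Gamma (b + d) * Gamma (c + d))⁻¹‖
  refine ⟨B * C * D * E * (K + 1), n, by positivity, fun a ha1 ha2 ↦ ?_⟩
  have e : (wilsonProduct a b c d)⁻¹ = (Gamma (a + b))⁻¹ * (Gamma (a + c))⁻¹ * (Gamma (a + d))⁻¹ *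
      Gamma (a + (b + c + d)) * (Gamma (b + c) * Gamma (b + d) * Gamma (c + d))⁻¹ := by
    rw [wilsonProduct, ← add_assoc, ← add_assoc, inv_div, div_eq_mul_inv]
    simp only [mul_inv]; ring
  rw [e]
  simp only [norm_mul]
  calc _ ≤ (B * Real.exp (Real.pi / 2 * |a.im|)) * (C * Real.exp (Real.pi / 2 * |a.im|)) *
        (D * Real.exp (Real.pi / 2 * |a.im|)) *
        (E * (1 + |a.im|) ^ n * Real.exp (-(Real.pi / 2 * |a.im|))) * (K + 1) := by
        gcongr
        exacts [h1 a ha1 ha2, h2 a ha1 ha2, h3 a ha1 ha2, h4 a ha1 ha2, (le_add_of_nonneg_right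
          zero_le_one)]
    _ = B * C * D * E * (K + 1) * (1 + |a.im|) ^ n * (Real.exp (Real.pi / 2 * |a.im|) *
        Real.exp (Real.pi / 2 * |a.im|) * Real.exp (Real.pi / 2 * |a.im|) *
        Real.exp (-(Real.pi / 2 * |a.im|))) := by ring
    _ = _ := by simp only [← Real.exp_add]; ring_nf

theorem differentiableAt_inv_wilsonProduct {a b c d : ℂ} (ha : 0 < a.re) (hb : 0 < b.re)
    (hc : 0 < c.re) (hd : 0 < d.re) :
    DifferentiableAt ℂ (fun a ↦ (wilsonProduct a b c d)⁻¹) a := by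
  have h : ∀ z : ℂ, 0 ≤ z.re → DifferentiableAt ℂ (fun a ↦ Gamma (a + z)) a := fun z hz ↦
    DifferentiableAt.comp (g := Gamma) (f := fun a ↦ a + z) a
      (differentiableAt_Gamma_of_re_pos (by simp; linarith)) (by fun_prop)
  have h5 := h (b + c + d) (by simp; linarith)
  simp only [← add_assoc] at h5
  refine DifferentiableAt.inv ?_ (wilsonProduct_ne_zero ha hb hc hd)
  have h1 := h b hb.le
  have h2 := h c hc.le
  have h3 := h d hd.le
  exact DifferentiableAt.div (by fun_prop) h5 (Gamma_ne_zero_of_re_pos (by simp; linarith))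

/-- The common recurrence makes the quotient 1-periodic in the first parameter, and the exponential
rates ±π cancel on 1 ≤ Re a ≤ 2, leaving polynomial growth. -/
theorem wilsonIntegral_div_wilsonProduct_eq {a a' b c d : ℂ} (ha : 0 < a.re) (ha' : 0 < a'.re)
    (hb : 0 < b.re) (hc : 0 < c.re) (hd : 0 < d.re) :
    wilsonIntegral a b c d / wilsonProduct a b c d =
      wilsonIntegral a' b c d / wilsonProduct a' b c d := by
  obtain ⟨C, n, hC, h1⟩ := exists_norm_wilsonIntegral_le hb hc hd
  obtain ⟨D, m, hD, h2⟩ := exists_norm_inv_wilsonProduct_le hb hc hd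
  refine apply_eq_apply_of_periodic_of_differentiableOn_re_pos (C := C * D) (k := n + m)
    (F := fun a ↦ wilsonIntegral a b c d / wilsonProduct a b c d) ?_ (fun z hz ↦ ?_)
    (fun z hz1 hz2 ↦ ?_) ha ha'
  · simp only [div_eq_mul_inv]
    exact (differentiableOn_wilsonIntegral hb hc hd).mul fun z hz ↦
      (differentiableAt_inv_wilsonProduct hz hb hc hd).differentiableWithinAt
  · have hs : z + b + c + d ≠ 0 := fun h ↦ by
      have := congrArg re h
      simp only [add_re, zero_re] at this
      linarith
    have hz' : 0 < (z + 1).re := by simp; linarith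
    rw [div_eq_div_iff (wilsonProduct_ne_zero hz' hb hc hd) (wilsonProduct_ne_zero hz hb hc hd)]
    refine mul_left_cancel₀ hs ?_
    linear_combination wilsonProduct z b c d * wilsonIntegral_add_one hz hb hc hd -
      wilsonIntegral z b c d * wilsonProduct_add_one hz hb hc hd
  · rw [div_eq_mul_inv, norm_mul]
    calc _ ≤ (C * (1 + |z.im|) ^ n * Real.exp (-(Real.pi * |z.im|))) *
          (D * (1 + |z.im|) ^ m * Real.exp (Real.pi * |z.im|)) :=
          mul_le_mul (h1 z hz1 hz2) (h2 z hz1 hz2) (norm_nonneg _) (by positivity)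
      _ = C * D * (1 + |z.im|) ^ (n + m) *
          (Real.exp (-(Real.pi * |z.im|)) * Real.exp (Real.pi * |z.im|)) := by ring
      _ = _ := by rw [← Real.exp_add]; simp

/-! ### The de Branges–Wilson integral: base case and evaluation. -/

/-- This is the duplication formula in disguise: by reflection the two pairs give 1/cos and 1/sin,
which cancel sin(2πz) = 2 sin(πz) cos(πz). -/
theorem gammaPair_one_half_mul_gammaPair_one_div (u : ℝ) :
    gammaPair (1 / 2) u * gammaPair 1 u *
      (Gamma (I * (2 * u : ℝ)) * Gamma (-(I * (2 * u : ℝ))))⁻¹ = 4 * Real.pi * u ^ 2 := by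
  rcases eq_or_ne u 0 with rfl | hu
  · simp
  have hu' : (u : ℂ) ≠ 0 := ofReal_ne_zero.2 hu
  have h1 := Gamma_mul_Gamma_one_sub (1 / 2 + I * u)
  have h2 := Gamma_mul_Gamma_one_sub (I * u)
  have e1 : (Real.pi : ℂ) * (1 / 2 + I * u) = Real.pi * (I * u) + Real.pi / 2 := by ring
  have e2 : (Real.pi : ℂ) * (I * u) = (Real.pi * u : ℝ) * I := by push_cast; ring
  have hcos : cos (Real.pi * (I * u)) ≠ 0 := by
    rw [e2, cos_mul_I, ← ofReal_cosh]
    exact ofReal_ne_zero.2 (Real.cosh_pos _).ne'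
  have hsin : sin (Real.pi * (I * u)) ≠ 0 := by
    rw [e2, sin_mul_I, ← ofReal_sinh]
    refine mul_ne_zero (ofReal_ne_zero.2 ?_) I_ne_zero
    rw [Ne, Real.sinh_eq_zero]
    exact mul_ne_zero Real.pi_ne_zero hu
  rw [show (1 : ℂ) - (1 / 2 + I * u) = 1 / 2 - I * u by ring, e1, sin_add_pi_div_two] at h1
  have e3 : (Real.pi : ℂ) * (I * (2 * u : ℝ)) = 2 * (Real.pi * (I * u)) := by push_cast; ring
  have hpi : (Real.pi : ℂ) ≠ 0 := ofReal_ne_zero.2 Real.pi_ne_zero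
  rw [inv_Gamma_mul_Gamma_neg, e3, sin_two_mul, gammaPair, gammaPair, h1, add_comm 1,
    Gamma_add_one _ (mul_ne_zero I_ne_zero hu'), mul_assoc (I * (u : ℂ)), h2]
  generalize sin (Real.pi * (I * u)) = S at hsin
  generalize cos (Real.pi * (I * u)) = T at hcos
  push_cast
  field_simp
  linear_combination (-4 : ℂ) * I_sq

theorem integrable_gammaPair_mul_gammaPair {a b : ℂ} (ha : 0 < a.re) (hb : 0 < b.re) :
    Integrable fun u : ℝ ↦ gammaPair a u * gammaPair b u := by
  obtain ⟨A, hA, h1⟩ := exists_norm_gammaPair_le ha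
  obtain ⟨C, hC, h2⟩ := exists_norm_gammaPair_le hb
  refine ((Real.integrable_exp_neg_mul_abs (c := 6) (by norm_num)).const_mul (A * C)).mono'
    ((continuous_gammaPair ha).mul (continuous_gammaPair hb)).aestronglyMeasurable
    (.of_forall fun u ↦ ?_)
  rw [norm_mul]
  calc _ ≤ (A * Real.exp (-(3 * |u|))) * (C * Real.exp (-(3 * |u|))) :=
        mul_le_mul (h1 u) (h2 u) (norm_nonneg _) (by positivity)
    _ = _ := by rw [mul_mul_mul_comm, ← Real.exp_add]; ring_nf

theorem integral_gammaPair_mul_gammaPair {a b : ℂ} (ha : 0 < a.re) (hb : 0 < b.re) :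
    ∫ u : ℝ, gammaPair a u * gammaPair b u = 2 * Real.pi *
      (Gamma (2 * a) * Gamma (a + b) ^ 2 * Gamma (2 * b) / Gamma (2 * a + 2 * b)) := by
  have h := integral_barnes_first ha hb ha hb
  rw [← two_mul, ← two_mul, show a + b + a + b = 2 * a + 2 * b by ring, add_comm b a] at h
  rw [sq, ← mul_assoc (Gamma (2 * a)), ← h]
  congr 1; ext u; simp only [gammaPair]; ring

/-- At these parameters the integrand is 4πu² times a squared pair. Writing u² = (1/4 + u²) - 1/4
and raising one parameter to 3/2 leaves two Barnes integrals. -/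
theorem wilsonIntegral_one_half : wilsonIntegral (1 / 2) (1 / 2) (1 / 2) 1 =
    4 * Real.pi * wilsonProduct (1 / 2) (1 / 2) (1 / 2) 1 := by
  have hh : 0 < (1 / 2 : ℂ).re := by norm_num
  have h3 : 0 < (1 / 2 + 1 : ℂ).re := by norm_num
  have hpt : ∀ u : ℝ, gammaPair (1 / 2) u * wilsonWeight (1 / 2) (1 / 2) 1 u =
      4 * Real.pi * (gammaPair (1 / 2 + 1) u * gammaPair (1 / 2) u -
        1 / 4 * (gammaPair (1 / 2) u * gammaPair (1 / 2) u)) := fun u ↦ by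
    rw [gammaPair_add_one hh, wilsonWeight]
    linear_combination gammaPair (1 / 2) u ^ 2 * gammaPair_one_half_mul_gammaPair_one_div u
  rw [wilsonIntegral]
  simp_rw [hpt]
  rw [integral_const_mul, integral_sub (integrable_gammaPair_mul_gammaPair h3 hh)
    ((integrable_gammaPair_mul_gammaPair hh hh).const_mul _), integral_const_mul,
    integral_gammaPair_mul_gammaPair h3 hh, integral_gammaPair_mul_gammaPair hh hh]
  have g1 : Gamma (1 / 2 + 1) = 1 / 2 * Gamma (1 / 2) := Gamma_add_one _ (by norm_num)
  have g2 : Gamma (1 / 2 + 1 / 2 + 1 / 2 + 1) = (1 / 2 + 1) * Gamma (1 / 2 + 1) := by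
    rw [← Gamma_add_one _ (by norm_num)]; norm_num
  have g3 : Gamma (2 * (1 / 2 + 1)) = 2 := by
    rw [show (2 : ℂ) * (1 / 2 + 1) = (2 : ℕ) + 1 by norm_num, Gamma_nat_eq_factorial]; rfl
  have g4 : Gamma (1 / 2 + 1 + 1 / 2) = 1 := by
    rw [show (1 / 2 + 1 + 1 / 2 : ℂ) = (1 : ℕ) + 1 by norm_num, Gamma_nat_eq_factorial]; simp
  have g5 : Gamma (2 * (1 / 2 + 1) + 2 * (1 / 2)) = 6 := by
    rw [show (2 * (1 / 2 + 1) + 2 * (1 / 2) : ℂ) = (3 : ℕ) + 1 by norm_num,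
      Gamma_nat_eq_factorial]; norm_num [Nat.factorial]
  have g6 : Gamma (2 * (1 / 2)) = 1 := by
    rw [show (2 * (1 / 2) : ℂ) = 1 by norm_num, Gamma_one]
  have g7 : Gamma (1 / 2 + 1 / 2) = 1 := by
    rw [show (1 / 2 + 1 / 2 : ℂ) = 1 by norm_num, Gamma_one]
  have g8 : Gamma (2 * (1 / 2) + 2 * (1 / 2)) = 1 := by
    rw [show (2 * (1 / 2) + 2 * (1 / 2) : ℂ) = (1 : ℕ) + 1 by norm_num,
      Gamma_nat_eq_factorial]; simp
  have g9 : Gamma (1 / 2) ^ 2 = Real.pi := by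
    rw [Gamma_one_half_eq, ← cpow_nat_mul]; norm_num
  have g10 : Gamma (1 / 2) ≠ 0 := Gamma_ne_zero_of_re_pos hh
  rw [wilsonProduct, g2, g1, g3, g4, g5, g6, g7, g8, ← g9]
  field_simp
  norm_num

/-- The integral of **de Branges and Wilson**. -/
theorem wilsonIntegral_eq {a b c d : ℂ} (ha : 0 < a.re) (hb : 0 < b.re) (hc : 0 < c.re)
    (hd : 0 < d.re) : wilsonIntegral a b c d = 4 * Real.pi * wilsonProduct a b c d := by
  have hh : 0 < (1 / 2 : ℂ).re := by norm_num
  have h1 : 0 < (1 : ℂ).re := by norm_num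
  -- Each parameter is moved to its base value while in first place; d goes to 1, and the last
  -- rotation puts it at the end.
  rw [← div_eq_iff (wilsonProduct_ne_zero ha hb hc hd),
    wilsonIntegral_div_wilsonProduct_eq ha hh hb hc hd,
    wilsonIntegral_rotate, wilsonProduct_rotate,
    wilsonIntegral_div_wilsonProduct_eq hb hh hc hd hh,
    wilsonIntegral_rotate, wilsonProduct_rotate,
    wilsonIntegral_div_wilsonProduct_eq hc hh hd hh hh,
    wilsonIntegral_rotate, wilsonProduct_rotate,
    wilsonIntegral_div_wilsonProduct_eq hd h1 hh hh hh,
    wilsonIntegral_rotate, wilsonProduct_rotate, wilsonIntegral_one_half,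
    mul_div_cancel_right₀ _ (wilsonProduct_ne_zero hh hh hh h1)]

/-! ### Changes of variables and absolute convergence. -/

theorem integrable_prod_of_norm_le_exp {f : ℝ × ℝ → ℂ} (hf : Continuous f) {c C : ℝ} (hc : 0 < c)
    (hb : ∀ x y, ‖f (x, y)‖ ≤ C * Real.exp (-(c * (|x| + |y|)))) : Integrable f := by
  have h := Real.integrable_exp_neg_mul_abs hc
  refine ((h.mul_prod h).const_mul C).mono' hf.aestronglyMeasurable (.of_forall fun p ↦ ?_)
  refine (hb p.1 p.2).trans (le_of_eq ?_)
  rw [← Real.exp_add]; ring_nf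

theorem integrable_prod_prod_of_norm_le_exp {f : ℝ × ℝ × ℝ → ℂ} (hf : Continuous f) {c C : ℝ}
    (hc : 0 < c) (hb : ∀ x y z, ‖f (x, y, z)‖ ≤ C * Real.exp (-(c * (|x| + |y| + |z|)))) :
    Integrable f := by
  have h := Real.integrable_exp_neg_mul_abs hc
  refine ((h.mul_prod (h.mul_prod h)).const_mul C).mono' hf.aestronglyMeasurable
    (.of_forall fun p ↦ ?_)
  refine (hb p.1 p.2.1 p.2.2).trans (le_of_eq ?_)
  rw [← Real.exp_add, ← Real.exp_add]; ring_nf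

/-- The coordinates of the Gauss–Givental side: p = s₁₁ + s₂₁, q = s₁₁ + s₂₂, with s = s₁₁
integrated first. -/
theorem measurePreserving_shear_sub :
    MeasurePreserving fun p : (ℝ × ℝ) × ℝ ↦ (p.2, p.1.1 - p.2, p.1.2 - p.2) := by
  have h1 : MeasurePreserving (fun p : ℝ × (ℝ × ℝ) ↦ (p.1, p.2 - (p.1, p.1)))
      (volume.prod volume) (volume.prod volume) :=
    (MeasurePreserving.id volume).skew_product (g := fun (s : ℝ) (p : ℝ × ℝ) ↦ p - (s, s))
      (by unfold Function.uncurry; fun_prop)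
      (.of_forall fun s ↦ (measurePreserving_sub_right volume ((s, s) : ℝ × ℝ)).map_eq)
  exact h1.comp Measure.measurePreserving_swap

/-- The coordinates of the Mellin–Barnes side. Taking the full sum w but half the difference u gives
a Jacobian of absolute value 1; the map is a composite of shears, a reflection and swaps. -/
theorem measurePreserving_half_add_half_sub :
    MeasurePreserving fun p : (ℝ × ℝ) × ℝ ↦
      (p.1.1, p.1.2 / 2 + p.2, p.1.2 / 2 - p.2) := by
  have h1 : MeasurePreserving (fun p : ℝ × ℝ ↦ (p.1, p.1 / 2 - p.2))
      (volume.prod volume) (volume.prod volume) :=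
    (MeasurePreserving.id volume).skew_product (g := fun (w : ℝ) (u : ℝ) ↦ w / 2 - u)
      (by unfold Function.uncurry; fun_prop)
      (.of_forall fun w ↦ (Measure.measurePreserving_sub_left volume (w / 2)).map_eq)
  have h2 : MeasurePreserving (fun p : ℝ × ℝ ↦ (p.1, p.2 - p.1))
      (volume.prod volume) (volume.prod volume) :=
    (MeasurePreserving.id volume).skew_product (g := fun (v : ℝ) (w : ℝ) ↦ w - v)
      (by unfold Function.uncurry; fun_prop)
      (.of_forall fun v ↦ (measurePreserving_sub_right volume v).map_eq)
  have h3 : MeasurePreserving (fun p : ℝ × ℝ ↦ (p.1 / 2 + p.2, p.1 / 2 - p.2))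
      (volume.prod volume) (volume.prod volume) := by
    convert (Measure.measurePreserving_swap.comp h2).comp
      (Measure.measurePreserving_swap.comp h1) using 1
    ext p
    · simp; ring
    · simp
  exact ((MeasurePreserving.id volume).prod h3).comp volume_preserving_prodAssoc

theorem MeasureTheory.MeasurePreserving.integral_comp_of_aestronglyMeasurable
    {α β E : Type*} [MeasurableSpace α] [MeasurableSpace β] [NormedAddCommGroup E]
    [NormedSpace ℝ E] {μ : Measure α} {ν : Measure β} {φ : α → β} (hφ : MeasurePreserving φ μ ν)
    {f : β → E} (hf : AEStronglyMeasurable f ν) : ∫ x, f (φ x) ∂μ = ∫ y, f y ∂ν := by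
  rw [← hφ.map_eq] at hf ⊢
  exact (integral_map hφ.measurable.aemeasurable hf).symm

/-- Three of the Gamma factors decay in s₁₁, s₂₁ and s₂₂ separately, which suffices; the other three
are merely bounded. -/
theorem integrable_gaussGiventalIntegrand {γ : Fin 3 → ℂ} (x : Fin 3 → ℝ)
    (h₁₂ : -(1 / 2) < (γ 0 - γ 1).im) (h₂₃ : -(1 / 2) < (γ 1 - γ 2).im) :
    Integrable (gaussGiventalIntegrand γ x) := by
  rw [sub_im] at h₁₂ h₂₃
  have r4 : 0 < (1 - I * (γ 0 - γ 2)).re := by simp; linarith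
  have r5 : 0 < (1 / 2 - I * (γ 1 - γ 2)).re := by simp; linarith
  have r6 : 0 < (1 / 2 - I * (γ 0 - γ 1)).re := by simp; linarith
  have r1 : 0 < (1 / 2 : ℂ).re := by norm_num
  obtain ⟨A, hA, h1⟩ := exists_norm_Gamma_sub_I_mul_le r1
  obtain ⟨B, hB, h2⟩ := exists_norm_Gamma_sub_I_mul_le (a := 1) (by norm_num)
  obtain ⟨C, hC, h4⟩ := exists_norm_Gamma_sub_I_mul_le r4
  obtain ⟨D, hD, h5⟩ := exists_norm_Gamma_sub_I_mul_le r5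
  obtain ⟨K, hK, h6⟩ := exists_norm_Gamma_sub_I_mul_le r6
  have hle : ∀ s : ℝ, Real.exp (-(3 / 2 * |s|)) ≤ 1 := fun s ↦
    Real.exp_le_one_iff.2 (by simp)
  refine integrable_prod_prod_of_norm_le_exp (c := 3 / 2) (C := A * A * B * C * D * K) ?_
    (by norm_num) fun s₁ s₂ s₃ ↦ ?_
  · unfold gaussGiventalIntegrand
    refine (((((Continuous.mul (by fun_prop) ?_).mul ?_).mul ?_).mul ?_).mul ?_).mul ?_ <;>
      refine Continuous.Gamma_of_re_pos (by fun_prop) fun s ↦ ?_ <;> simp <;> linarith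
  · have e0 : I * s₂ * (x 0 - x 1) + I * s₁ * (x 0 - x 2) + I * s₃ * (x 1 - x 2) =
        (s₂ * (x 0 - x 1) + s₁ * (x 0 - x 2) + s₃ * (x 1 - x 2) : ℝ) * I := by push_cast; ring
    have e3 : 1 - I * s₁ - I * s₃ = 1 - I * (s₁ + s₃ : ℝ) := by push_cast; ring
    have e4 : -I * (γ 0 - γ 2 + s₁ + s₂) + 1 = 1 - I * (γ 0 - γ 2) - I * (s₁ + s₂ : ℝ) := by
      push_cast; ring
    have e5 : -I * (γ 1 - γ 2 + s₃) + 1 / 2 = 1 / 2 - I * (γ 1 - γ 2) - I * s₃ := by ring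
    have e6 : -I * (γ 0 - γ 1 + s₁) + 1 / 2 = 1 / 2 - I * (γ 0 - γ 1) - I * s₁ := by ring
    simp only [gaussGiventalIntegrand, norm_mul]
    rw [e0, e3, e4, e5, e6, norm_exp_ofReal_mul_I, one_mul]
    calc _ ≤ (A * Real.exp (-(3 / 2 * |s₂|))) * (A * Real.exp (-(3 / 2 * |s₁|))) * (B * 1) *
          (C * 1) * (D * Real.exp (-(3 / 2 * |s₃|))) * (K * 1) := by
          gcongr
          · exact h1 s₂
          · exact h1 s₁
          · exact (h2 _).trans (mul_le_mul_of_nonneg_left (hle _) hB.le)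
          · exact (h4 _).trans (mul_le_mul_of_nonneg_left (hle _) hC.le)
          · exact h5 s₃
          · exact (h6 _).trans (mul_le_mul_of_nonneg_left (hle _) hK.le)
      _ = A * A * B * C * D * K * (Real.exp (-(3 / 2 * |s₂|)) * Real.exp (-(3 / 2 * |s₁|)) *
          Real.exp (-(3 / 2 * |s₃|))) := by ring
      _ = _ := by simp only [← Real.exp_add]; ring_nf

/-- The growth exp(4|v - w|) is beaten by decay of rate 9/2 in each of |v| and |w|, leaving 1/2.
Half of this is traded, through |t| ≤ |v| + |v - t|, for decay in t; hence the rate 1/4. -/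
theorem integrable_mellinBarnesIntegrand {γ : Fin 3 → ℂ} (x : Fin 3 → ℝ)
    (hγ : ∀ i, (γ i).im < 1 / 2) : Integrable (mellinBarnesIntegrand γ x) := by
  have r1 : 0 < (1 / 2 : ℂ).re := by norm_num
  have r2 : ∀ i, 0 < (1 / 2 + I * γ i).re := fun i ↦ by
    have := hγ i
    simp; linarith
  obtain ⟨A, hA, h1⟩ := exists_norm_Gamma_add_I_mul_le r1
  choose B hB h2 using fun i ↦ exists_norm_Gamma_sub_I_mul_le (r2 i)
  obtain ⟨D, hD, h3⟩ := exists_norm_inv_Gamma_mul_Gamma_neg_le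
  have e1 : ∀ t s : ℝ, I * ((t : ℂ) - s) + 1 / 2 = 1 / 2 + I * (t - s : ℝ) := fun t s ↦ by
    push_cast; ring
  have e2 : ∀ (i : Fin 3) (t : ℝ), I * (γ i - t) + 1 / 2 = 1 / 2 + I * γ i - I * t :=
    fun i t ↦ by ring
  have e3 : ∀ t s : ℝ, 1 / (Gamma (I * t - I * s) * Gamma (I * s - I * t)) =
      (Gamma (I * (t - s : ℝ)) * Gamma (-(I * (t - s : ℝ))))⁻¹ := fun t s ↦ by
    rw [one_div]; congr 3 <;> push_cast <;> ring
  refine integrable_prod_prod_of_norm_le_exp (c := 1 / 4)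
    (C := D * A * A * ((B 0 * B 0) * (B 1 * B 1) * (B 2 * B 2))) ?_ (by norm_num)
    fun t v w ↦ ?_
  · unfold mellinBarnesIntegrand
    simp only [e1, e2, e3, Fin.prod_univ_three]
    refine (((Continuous.mul ?_ (by fun_prop)).mul ?_).mul ?_).mul
      (((Continuous.mul ?_ ?_).mul (Continuous.mul ?_ ?_)).mul (Continuous.mul ?_ ?_))
    · exact continuous_inv_Gamma_mul_Gamma_neg.comp
        (f := fun τ : ℝ × ℝ × ℝ ↦ I * (τ.2.1 - τ.2.2 : ℝ)) (by fun_prop)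
    all_goals
      refine Continuous.Gamma_of_re_pos (by fun_prop) fun s ↦ ?_
    · simp
    · simp
    · simpa using r2 0
    · simpa using r2 0
    · simpa using r2 1
    · simpa using r2 1
    · simpa using r2 2
    · simpa using r2 2
  · have e0 : I * (x 1 - x 2) * (v + w) + I * (x 0 - x 1) * t =
        ((x 1 - x 2) * (v + w) + (x 0 - x 1) * t : ℝ) * I := by push_cast; ring
    simp only [mellinBarnesIntegrand, Fin.prod_univ_three, norm_mul, e1, e2]
    rw [e0, e3, norm_exp_ofReal_mul_I, mul_one]
    calc _ ≤ (D * Real.exp (4 * |v - w|)) * (A * Real.exp (-(3 / 2 * |v - t|))) *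
          (A * Real.exp (-(3 / 2 * |w - t|))) *
          (((B 0 * Real.exp (-(3 / 2 * |v|))) * (B 0 * Real.exp (-(3 / 2 * |w|)))) *
          ((B 1 * Real.exp (-(3 / 2 * |v|))) * (B 1 * Real.exp (-(3 / 2 * |w|)))) *
          ((B 2 * Real.exp (-(3 / 2 * |v|))) * (B 2 * Real.exp (-(3 / 2 * |w|))))) := by
          have p0 := (hB 0).le
          have p1 := (hB 1).le
          have p2 := (hB 2).le
          gcongr
          exacts [h3 _, h1 _, h1 _, h2 0 v, h2 0 w, h2 1 v, h2 1 w, h2 2 v, h2 2 w]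
      _ = D * A * A * ((B 0 * B 0) * (B 1 * B 1) * (B 2 * B 2)) * (Real.exp (4 * |v - w|) *
          Real.exp (-(3 / 2 * |v - t|)) * Real.exp (-(3 / 2 * |w - t|)) *
          Real.exp (-(3 / 2 * |v|)) * Real.exp (-(3 / 2 * |w|)) *
          Real.exp (-(3 / 2 * |v|)) * Real.exp (-(3 / 2 * |w|)) *
          Real.exp (-(3 / 2 * |v|)) * Real.exp (-(3 / 2 * |w|))) := by ring
      _ ≤ _ := by
          have q0 := (hB 0).le
          have q1 := (hB 1).le
          have q2 := (hB 2).le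
          refine mul_le_mul_of_nonneg_left ?_ (by positivity)
          simp only [← Real.exp_add]
          refine Real.exp_le_exp.2 ?_
          have q3 := abs_sub v w
          have q4 : |t| ≤ |v| + |v - t| := by simpa using abs_sub v (v - t)
          linarith [abs_nonneg (v - t), abs_nonneg (w - t), abs_nonneg v, abs_nonneg w]

/-! ### The common kernel and the two inner integrals. -/

/-- The function whose double Fourier integral over `t` and `w` is the `gl₃(ℝ)`-Whittaker
function. -/
noncomputable def whittakerKernel (γ : Fin 3 → ℂ) (x : Fin 3 → ℝ) (t w : ℂ) : ℂ :=
  exp (I * (x 0 - x 1) * t + I * (x 1 - x 2) * w) *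
    (Gamma (1 + I * (γ 0 - t)) * Gamma (1 + I * (γ 1 - t)) * Gamma (1 + I * (γ 2 - t)) *
      Gamma (1 + I * (γ 0 + γ 1 - w)) * Gamma (1 + I * (γ 0 + γ 2 - w)) *
      Gamma (1 + I * (γ 1 + γ 2 - w)) * (Gamma (2 + I * (γ 0 + γ 1 + γ 2 - t - w)))⁻¹)

/-- In u this is a de Branges–Wilson integral with parameters 1/2 + i(w/2 - t) and 1/2 + i(γᵢ -
w/2). Their pairwise sums are the six Gamma arguments of the kernel, their total the argument of the
reciprocal. -/
theorem integral_mellinBarnesIntegrand_inner {γ : Fin 3 → ℂ} (x : Fin 3 → ℝ)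
    (hγ : ∀ i, (γ i).im < 1 / 2) (t w : ℝ) :
    ∫ u : ℝ, mellinBarnesIntegrand γ x (t, w / 2 + u, w / 2 - u) =
      4 * Real.pi * whittakerKernel γ x t w := by
  have ha : 0 < (1 / 2 + I * (w / 2 - t) : ℂ).re := by simp
  have hb : ∀ i, 0 < (1 / 2 + I * (γ i - w / 2)).re := fun i ↦ by
    have := hγ i
    simp; linarith
  have h := wilsonIntegral_eq ha (hb 0) (hb 1) (hb 2)
  have hpt : ∀ u : ℝ, mellinBarnesIntegrand γ x (t, w / 2 + u, w / 2 - u) =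
      exp (I * (x 0 - x 1) * t + I * (x 1 - x 2) * w) * (gammaPair (1 / 2 + I * (w / 2 - t)) u *
        wilsonWeight (1 / 2 + I * (γ 0 - w / 2)) (1 / 2 + I * (γ 1 - w / 2))
          (1 / 2 + I * (γ 2 - w / 2)) u) := fun u ↦ by
    simp only [mellinBarnesIntegrand, Fin.prod_univ_three, gammaPair, wilsonWeight]
    push_cast
    ring_nf
  simp_rw [hpt]
  rw [integral_const_mul, ← wilsonIntegral, h, wilsonProduct, whittakerKernel]
  ring_nf

/-- With p and q fixed, four of the six Gamma factors depend on s and form a Barnes integral; the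
remaining two complete the kernel. -/
theorem integral_gaussGiventalIntegrand_inner {γ : Fin 3 → ℂ} (x : Fin 3 → ℝ)
    (h₁₂ : -(1 / 2) < (γ 0 - γ 1).im) (h₂₃ : -(1 / 2) < (γ 1 - γ 2).im) (p q : ℝ) :
    exp (I * (x 0 - x 1) * γ 0 + I * (x 1 - x 2) * (γ 0 + γ 1)) *
      ∫ s : ℝ, gaussGiventalIntegrand γ x (s, p - s, q - s) =
      2 * Real.pi * whittakerKernel γ x (γ 0 + p) (γ 0 + γ 1 + q) := by
  rw [sub_im] at h₁₂ h₂₃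
  have ha : 0 < (1 / 2 - I * p : ℂ).re := by simp
  have hb : 0 < (1 / 2 - I * (γ 1 - γ 2 + q)).re := by simp; linarith
  have hc : 0 < (1 / 2 : ℂ).re := by simp
  have hd : 0 < (1 / 2 - I * (γ 0 - γ 1)).re := by simp; linarith
  have h := integral_barnes_first ha hb hc hd
  have hpt : ∀ s : ℝ, gaussGiventalIntegrand γ x (s, p - s, q - s) =
      exp (I * (x 0 - x 1) * p + I * (x 1 - x 2) * q) * Gamma (1 - I * q) *
        Gamma (1 + I * (γ 2 - (γ 0 + p))) * (Gamma (1 / 2 - I * p + I * s) *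
        Gamma (1 / 2 - I * (γ 1 - γ 2 + q) + I * s) * Gamma (1 / 2 - I * s) *
        Gamma (1 / 2 - I * (γ 0 - γ 1) - I * s)) := fun s ↦ by
    simp only [gaussGiventalIntegrand]
    push_cast
    ring_nf
  simp_rw [hpt]
  rw [integral_const_mul, h, whittakerKernel,
    show I * ((x 0 : ℂ) - x 1) * (γ 0 + p) + I * (x 1 - x 2) * (γ 0 + γ 1 + q) =
      (I * (x 0 - x 1) * γ 0 + I * (x 1 - x 2) * (γ 0 + γ 1)) +
      (I * (x 0 - x 1) * p + I * (x 1 - x 2) * q) by ring,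
    exp_add (I * (x 0 - x 1) * γ 0 + I * (x 1 - x 2) * (γ 0 + γ 1))]
  ring_nf

/-! ### The contour shift for the kernel. -/

theorem re_one_add_I_mul_sub_pos {β : ℂ} {y : ℝ} (h0 : β.im < 1) (h1 : β.im < 1 + y) {t : ℂ}
    (ht : t.im ∈ Set.uIcc 0 y) : 0 < (1 + I * (β - t)).re := by
  have e : (1 + I * (β - t)).re = 1 - β.im + t.im := by simp; ring
  rw [e]
  rcases Set.mem_uIcc.1 ht with h | h <;> linarith

theorem exists_norm_Gamma_one_add_I_mul_sub_le {β : ℂ} {y : ℝ} (h0 : β.im < 1)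
    (h1 : β.im < 1 + y) : ∃ C : ℝ, 0 < C ∧ ∀ t : ℂ, t.im ∈ Set.uIcc 0 y →
      ‖Gamma (1 + I * (β - t))‖ ≤ C * Real.exp (-(3 / 2 * |t.re|)) := by
  have hδ : 0 < min (1 - β.im) (1 - β.im + y) := lt_min (by linarith) (by linarith)
  obtain ⟨C, hC, h⟩ := exists_norm_Gamma_le_exp hδ (max (1 - β.im) (1 - β.im + y))
  refine ⟨C * Real.exp (3 / 2 * |β.re|), by positivity, fun t ht ↦ ?_⟩
  have e1 : (1 + I * (β - t)).re = 1 - β.im + t.im := by simp; ring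
  have e2 : (1 + I * (β - t)).im = β.re - t.re := by simp
  have h2 := h (1 + I * (β - t)) (by
    rw [e1]
    rcases Set.mem_uIcc.1 ht with h | h
    · exact (min_le_left _ _).trans (by linarith)
    · exact (min_le_right _ _).trans (by linarith)) (by
    rw [e1]
    rcases Set.mem_uIcc.1 ht with h | h
    · exact le_trans (by linarith) (le_max_right _ _)
    · exact le_trans (by linarith) (le_max_left _ _))
  refine h2.trans ?_
  rw [e2, mul_assoc, ← Real.exp_add]
  have h3 : |t.re| ≤ |β.re| + |β.re - t.re| := by simpa using abs_sub β.re (β.re - t.re)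
  exact mul_le_mul_of_nonneg_left (Real.exp_le_exp.2 (by linarith)) hC.le

/-- The real part is affine in Im t and Im w, so only the corners matter. The bound 1/2 comes from
Im t = Im w = 0, where the sum of the three Im γᵢ is below 3/2. -/
theorem one_half_le_re_two_add_I_mul_sub {γ : Fin 3 → ℂ} (hγ : ∀ i, (γ i).im < 1 / 2)
    (h₁₂ : -(1 / 2) < (γ 0 - γ 1).im) (h₂₃ : -(1 / 2) < (γ 1 - γ 2).im) {t w : ℂ}
    (ht : t.im ∈ Set.uIcc 0 (γ 0).im) (hw : w.im ∈ Set.uIcc 0 (γ 0 + γ 1).im) :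
    1 / 2 ≤ (2 + I * (γ 0 + γ 1 + γ 2 - t - w)).re := by
  have e : (2 + I * (γ 0 + γ 1 + γ 2 - t - w)).re =
      2 - (γ 0).im - (γ 1).im - (γ 2).im + t.im + w.im := by simp; ring
  have g0 := hγ 0
  have g1 := hγ 1
  have g2 := hγ 2
  rw [sub_im] at h₁₂ h₂₃
  rw [add_im] at hw
  rw [e]
  rcases Set.mem_uIcc.1 ht with h | h <;> rcases Set.mem_uIcc.1 hw with h' | h' <;> linarith

theorem differentiableAt_whittakerKernel {γ : Fin 3 → ℂ} (x : Fin 3 → ℝ)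
    (hγ : ∀ i, (γ i).im < 1 / 2)
    (h₁₂ : -(1 / 2) < (γ 0 - γ 1).im) (h₂₃ : -(1 / 2) < (γ 1 - γ 2).im) {t w : ℂ}
    (ht : t.im ∈ Set.uIcc 0 (γ 0).im) (hw : w.im ∈ Set.uIcc 0 (γ 0 + γ 1).im) :
    DifferentiableAt ℂ (fun p : ℂ × ℂ ↦ whittakerKernel γ x p.1 p.2) (t, w) := by
  have g0 := hγ 0
  have g1 := hγ 1
  have g2 := hγ 2
  have h := one_half_le_re_two_add_I_mul_sub hγ h₁₂ h₂₃ ht hw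
  rw [sub_im] at h₁₂ h₂₃
  have hc : ∀ {f : ℂ × ℂ → ℂ}, DifferentiableAt ℂ f (t, w) → 0 < (f (t, w)).re →
      DifferentiableAt ℂ (fun p ↦ Gamma (f p)) (t, w) := fun hf hp ↦
    (differentiableAt_Gamma_of_re_pos hp).comp _ hf
  unfold whittakerKernel
  refine DifferentiableAt.mul (by fun_prop) (DifferentiableAt.mul (DifferentiableAt.mul
    (DifferentiableAt.mul (DifferentiableAt.mul (DifferentiableAt.mul (DifferentiableAt.mul
    ?_ ?_) ?_) ?_) ?_) ?_) (DifferentiableAt.inv ?_ (Gamma_ne_zero_of_re_pos (by linarith))))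
  · exact hc (by fun_prop) (re_one_add_I_mul_sub_pos (by linarith) (by linarith) ht)
  · exact hc (by fun_prop) (re_one_add_I_mul_sub_pos (by linarith) (by linarith) ht)
  · exact hc (by fun_prop) (re_one_add_I_mul_sub_pos (by linarith) (by linarith) ht)
  · exact hc (by fun_prop) (re_one_add_I_mul_sub_pos (by simp; linarith) (by simp) hw)
  · exact hc (by fun_prop) (re_one_add_I_mul_sub_pos (by simp; linarith) (by simp; linarith) hw)
  · exact hc (by fun_prop) (re_one_add_I_mul_sub_pos (by simp; linarith) (by simp; linarith) hw)
  · exact hc (by fun_prop) (by linarith)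

/-- Three Gamma factors in each variable give rate 9/2, and the reciprocal costs at most 2 because
π/2 < 2. The exponential prefactor is bounded since the imaginary parts stay in a compact set. -/
theorem exists_norm_whittakerKernel_le {γ : Fin 3 → ℂ} (x : Fin 3 → ℝ) (hγ : ∀ i, (γ i).im < 1 / 2)
    (h₁₂ : -(1 / 2) < (γ 0 - γ 1).im) (h₂₃ : -(1 / 2) < (γ 1 - γ 2).im) :
    ∃ C : ℝ, 0 < C ∧ ∀ t w : ℂ, t.im ∈ Set.uIcc 0 (γ 0).im → w.im ∈ Set.uIcc 0 (γ 0 + γ 1).im →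
      ‖whittakerKernel γ x t w‖ ≤ C * Real.exp (-(1 * (|t.re| + |w.re|))) := by
  have g0 := hγ 0
  have g1 := hγ 1
  have g2 := hγ 2
  have hlow := fun t w ↦ one_half_le_re_two_add_I_mul_sub (t := t) (w := w) hγ h₁₂ h₂₃
  rw [sub_im] at h₁₂ h₂₃
  obtain ⟨C₁, p₁, b₁⟩ := exists_norm_Gamma_one_add_I_mul_sub_le (β := γ 0) (y := (γ 0).im)
    (by linarith) (by linarith)
  obtain ⟨C₂, p₂, b₂⟩ := exists_norm_Gamma_one_add_I_mul_sub_le (β := γ 1) (y := (γ 0).im)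
    (by linarith) (by linarith)
  obtain ⟨C₃, p₃, b₃⟩ := exists_norm_Gamma_one_add_I_mul_sub_le (β := γ 2) (y := (γ 0).im)
    (by linarith) (by linarith)
  obtain ⟨C₄, p₄, b₄⟩ := exists_norm_Gamma_one_add_I_mul_sub_le (β := γ 0 + γ 1)
    (y := (γ 0 + γ 1).im) (by simp; linarith) (by simp)
  obtain ⟨C₅, p₅, b₅⟩ := exists_norm_Gamma_one_add_I_mul_sub_le (β := γ 0 + γ 2)
    (y := (γ 0 + γ 1).im) (by simp; linarith) (by simp; linarith)
  obtain ⟨C₆, p₆, b₆⟩ := exists_norm_Gamma_one_add_I_mul_sub_le (β := γ 1 + γ 2)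
    (y := (γ 0 + γ 1).im) (by simp; linarith) (by simp; linarith)
  obtain ⟨C₇, p₇, b₇⟩ := exists_norm_Gamma_inv_le
    (2 + |(γ 0 + γ 1 + γ 2).im| + |(γ 0).im| + |(γ 0 + γ 1).im|)
  set S := γ 0 + γ 1 + γ 2 with hS
  set M := Real.exp (|x 0 - x 1| * |(γ 0).im| + |x 1 - x 2| * |(γ 0 + γ 1).im|)
  have habs : ∀ {y z : ℝ}, z ∈ Set.uIcc 0 y → |z| ≤ |y| := fun {y z} hz ↦ by
    simpa using Set.abs_sub_left_of_mem_uIcc hz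
  refine ⟨M * (C₁ * C₂ * C₃ * C₄ * C₅ * C₆ * (C₇ * Real.exp (2 * |S.re|))), by positivity,
    fun t w ht hw ↦ ?_⟩
  have hE : ‖exp (I * (x 0 - x 1) * t + I * (x 1 - x 2) * w)‖ ≤ M := by
    rw [norm_exp]
    refine Real.exp_le_exp.2 ?_
    have e : (I * (x 0 - x 1) * t + I * (x 1 - x 2) * w).re =
        -((x 0 - x 1) * t.im) + -((x 1 - x 2) * w.im) := by simp
    rw [e]
    refine add_le_add ((neg_le_abs _).trans ?_) ((neg_le_abs _).trans ?_) <;> rw [abs_mul]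
    · exact mul_le_mul_of_nonneg_left (habs ht) (abs_nonneg _)
    · exact mul_le_mul_of_nonneg_left (habs hw) (abs_nonneg _)
  have h7 : ‖(Gamma (2 + I * (S - t - w)))⁻¹‖ ≤
      C₇ * Real.exp (2 * |S.re|) * Real.exp (2 * (|t.re| + |w.re|)) := by
    have e1 : (2 + I * (S - t - w)).re = 2 - S.im + t.im + w.im := by simp; ring
    have e2 : (2 + I * (S - t - w)).im = S.re - t.re - w.re := by simp
    refine (b₇ _ (hlow t w ht hw) ?_).trans ?_
    · rw [e1]
      linarith [neg_le_abs S.im, (le_abs_self _).trans (habs ht), (le_abs_self _).trans (habs hw)]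
    · rw [mul_assoc, ← Real.exp_add, e2]
      refine mul_le_mul_of_nonneg_left (Real.exp_le_exp.2 ?_) p₇.le
      have q1 := abs_sub (S.re - t.re) w.re
      have q2 := abs_sub S.re t.re
      have q3 : Real.pi / 2 * |S.re - t.re - w.re| ≤ 2 * |S.re - t.re - w.re| := by
        gcongr
        linarith [Real.pi_lt_four]
      linarith
  rw [whittakerKernel]
  simp only [norm_mul]
  calc _ ≤ M * ((C₁ * Real.exp (-(3 / 2 * |t.re|))) * (C₂ * Real.exp (-(3 / 2 * |t.re|))) *
        (C₃ * Real.exp (-(3 / 2 * |t.re|))) * (C₄ * Real.exp (-(3 / 2 * |w.re|))) *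
        (C₅ * Real.exp (-(3 / 2 * |w.re|))) * (C₆ * Real.exp (-(3 / 2 * |w.re|))) *
        (C₇ * Real.exp (2 * |S.re|) * Real.exp (2 * (|t.re| + |w.re|)))) := by
        gcongr
        exacts [b₁ t ht, b₂ t ht, b₃ t ht, b₄ w hw, b₅ w hw, b₆ w hw]
    _ = M * (C₁ * C₂ * C₃ * C₄ * C₅ * C₆ * (C₇ * Real.exp (2 * |S.re|))) *
        (Real.exp (-(3 / 2 * |t.re|)) * Real.exp (-(3 / 2 * |t.re|)) *
        Real.exp (-(3 / 2 * |t.re|)) * Real.exp (-(3 / 2 * |w.re|)) *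
        Real.exp (-(3 / 2 * |w.re|)) * Real.exp (-(3 / 2 * |w.re|)) *
        Real.exp (2 * (|t.re| + |w.re|))) := by ring
    _ ≤ _ := by
        refine mul_le_mul_of_nonneg_left ?_ (by positivity)
        simp only [← Real.exp_add]
        exact Real.exp_le_exp.2 (by linarith [abs_nonneg t.re, abs_nonneg w.re])

theorem integrable_whittakerKernel {γ : Fin 3 → ℂ} (x : Fin 3 → ℝ) (hγ : ∀ i, (γ i).im < 1 / 2)
    (h₁₂ : -(1 / 2) < (γ 0 - γ 1).im) (h₂₃ : -(1 / 2) < (γ 1 - γ 2).im) {y z : ℝ}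
    (hy : y ∈ Set.uIcc 0 (γ 0).im) (hz : z ∈ Set.uIcc 0 (γ 0 + γ 1).im) :
    Integrable fun p : ℝ × ℝ ↦ whittakerKernel γ x (p.1 + y * I) (p.2 + z * I) := by
  obtain ⟨C, hC, h⟩ := exists_norm_whittakerKernel_le x hγ h₁₂ h₂₃
  refine integrable_prod_of_norm_le_exp (continuous_iff_continuousAt.2 fun p ↦ ?_) one_pos
    (fun t w ↦ ?_) (C := C)
  · exact ContinuousAt.comp (f := fun p : ℝ × ℝ ↦ ((p.1 + y * I, p.2 + z * I) : ℂ × ℂ))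
      (g := fun p : ℂ × ℂ ↦ whittakerKernel γ x p.1 p.2)
      (differentiableAt_whittakerKernel x hγ h₁₂ h₂₃ (by simpa using hy)
        (by simpa using hz)).continuousAt (by fun_prop)
  · simpa using h (t + y * I) (w + z * I) (by simpa using hy) (by simpa using hz)

/-- The double integral of `whittakerKernel` does not change under a shift of both contours. -/
theorem integral_whittakerKernel_shift {γ : Fin 3 → ℂ} (x : Fin 3 → ℝ) (hγ : ∀ i, (γ i).im < 1 / 2)
    (h₁₂ : -(1 / 2) < (γ 0 - γ 1).im) (h₂₃ : -(1 / 2) < (γ 1 - γ 2).im) :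
    ∫ p : ℝ × ℝ, whittakerKernel γ x (γ 0 + p.1) (γ 0 + γ 1 + p.2) =
      ∫ p : ℝ × ℝ, whittakerKernel γ x p.1 p.2 := by
  obtain ⟨C, hC, h⟩ := exists_norm_whittakerKernel_le x hγ h₁₂ h₂₃
  have hd := fun t w ↦ differentiableAt_whittakerKernel (t := t) (w := w) x hγ h₁₂ h₂₃
  set a := (γ 0).im
  set b := (γ 0 + γ 1).im
  have ha := Set.right_mem_uIcc (a := (0 : ℝ)) (b := a)
  have ha0 := Set.left_mem_uIcc (a := (0 : ℝ)) (b := a)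
  have hb := Set.right_mem_uIcc (a := (0 : ℝ)) (b := b)
  have hb0 := Set.left_mem_uIcc (a := (0 : ℝ)) (b := b)
  -- Translation invariance removes the real parts of γ₁ and γ₁ + γ₂; only the imaginary shifts need
  -- Cauchy's theorem, one variable at a time between uses of Fubini.
  have htrans := integral_add_right_eq_self (μ := (volume : Measure (ℝ × ℝ)))
    (fun p : ℝ × ℝ ↦ whittakerKernel γ x (p.1 + a * I) (p.2 + b * I)) ((γ 0).re, (γ 0 + γ 1).re)
  have hpt : ∀ p : ℝ × ℝ, whittakerKernel γ x (γ 0 + p.1) (γ 0 + γ 1 + p.2) =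
      whittakerKernel γ x ((p + ((γ 0).re, (γ 0 + γ 1).re)).1 + a * I)
        ((p + ((γ 0).re, (γ 0 + γ 1).re)).2 + b * I) := fun p ↦ by
    congr 1
    · apply Complex.ext <;> simp [a, add_comm]
    · refine Complex.ext ?_ (by simp [b])
      simp
      ring
  simp_rw [hpt]
  rw [htrans]
  have i1 := integrable_whittakerKernel x hγ h₁₂ h₂₃ ha hb
  have i2 := integrable_whittakerKernel x hγ h₁₂ h₂₃ ha0 hb
  have i3 := integrable_whittakerKernel x hγ h₁₂ h₂₃ ha0 hb0
  have s1 : ∀ w : ℝ, ∫ t : ℝ, whittakerKernel γ x (t + (0 : ℝ) * I) (w + b * I) =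
      ∫ t : ℝ, whittakerKernel γ x (t + a * I) (w + b * I) := fun w ↦ by
    refine integral_add_mul_I_eq_of_norm_le_exp (c := 1) (C := C)
      (f := fun t ↦ whittakerKernel γ x t (w + b * I)) one_pos
      (fun t ht ↦ ?_) (fun t ht ↦ ?_)
    · exact (hd t (w + b * I) ht (by simp)).comp t
        (f := fun t ↦ ((t, w + b * I) : ℂ × ℂ)) (by fun_prop)
    · refine (h t (w + b * I) ht (by simp)).trans ?_
      refine mul_le_mul_of_nonneg_left (Real.exp_le_exp.2 ?_) hC.le
      have := abs_nonneg (w + b * I).re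
      linarith
  have s2 : ∀ t : ℝ, ∫ w : ℝ, whittakerKernel γ x (t + (0 : ℝ) * I) (w + (0 : ℝ) * I) =
      ∫ w : ℝ, whittakerKernel γ x (t + (0 : ℝ) * I) (w + b * I) := fun t ↦ by
    refine integral_add_mul_I_eq_of_norm_le_exp (c := 1) (C := C)
      (f := fun w ↦ whittakerKernel γ x (t + (0 : ℝ) * I) w) one_pos
      (fun w hw ↦ ?_) (fun w hw ↦ ?_)
    · exact (hd (t + (0 : ℝ) * I) w (by simp) hw).comp w
        (f := fun w ↦ ((t + (0 : ℝ) * I, w) : ℂ × ℂ)) (by fun_prop)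
    · refine (h (t + (0 : ℝ) * I) w (by simp) hw).trans ?_
      refine mul_le_mul_of_nonneg_left (Real.exp_le_exp.2 ?_) hC.le
      have := abs_nonneg (t + (0 : ℝ) * I).re
      linarith
  calc _ = ∫ w : ℝ, ∫ t : ℝ, whittakerKernel γ x (t + a * I) (w + b * I) :=
        integral_prod_symm _ i1
    _ = ∫ w : ℝ, ∫ t : ℝ, whittakerKernel γ x (t + (0 : ℝ) * I) (w + b * I) := by simp_rw [s1]
    _ = ∫ t : ℝ, ∫ w : ℝ, whittakerKernel γ x (t + (0 : ℝ) * I) (w + b * I) := by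
        rw [← integral_prod_symm _ i2, ← integral_prod _ i2]
    _ = ∫ t : ℝ, ∫ w : ℝ, whittakerKernel γ x (t + (0 : ℝ) * I) (w + (0 : ℝ) * I) := by
        simp_rw [s2]
    _ = ∫ p : ℝ × ℝ, whittakerKernel γ x (p.1 + (0 : ℝ) * I) (p.2 + (0 : ℝ) * I) :=
        (integral_prod _ i3).symm
    _ = _ := by simp

/-! ### Reduction of both integrals to the double integral, and conclusion. -/

theorem integral_mellinBarnesIntegrand {γ : Fin 3 → ℂ} (x : Fin 3 → ℝ)
    (hγ : ∀ i, (γ i).im < 1 / 2) : ∫ τ, mellinBarnesIntegrand γ x τ =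
      4 * Real.pi * ∫ p : ℝ × ℝ, whittakerKernel γ x p.1 p.2 := by
  have hi := integrable_mellinBarnesIntegrand x hγ
  have hΦ := measurePreserving_half_add_half_sub
  rw [← hΦ.integral_comp_of_aestronglyMeasurable hi.1, ← integral_const_mul]
  refine (integral_prod _ ((hΦ.integrable_comp hi.1).2 hi)).trans ?_
  congr 1; ext p
  exact integral_mellinBarnesIntegrand_inner x hγ p.1 p.2

theorem integral_gaussGiventalIntegrand {γ : Fin 3 → ℂ} (x : Fin 3 → ℝ)
    (h₁₂ : -(1 / 2) < (γ 0 - γ 1).im) (h₂₃ : -(1 / 2) < (γ 1 - γ 2).im) :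
    exp (I * (x 0 - x 1) * γ 0 + I * (x 1 - x 2) * (γ 0 + γ 1)) *
      ∫ s, gaussGiventalIntegrand γ x s =
      2 * Real.pi * ∫ p : ℝ × ℝ, whittakerKernel γ x (γ 0 + p.1) (γ 0 + γ 1 + p.2) := by
  have hi := integrable_gaussGiventalIntegrand x h₁₂ h₂₃
  have hΨ := measurePreserving_shear_sub
  rw [← hΨ.integral_comp_of_aestronglyMeasurable hi.1, ← integral_const_mul (2 * Real.pi : ℂ)]
  refine (congrArg _ (integral_prod _ ((hΨ.integrable_comp hi.1).2 hi))).trans ?_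
  rw [← integral_const_mul]
  congr 1; ext p
  exact integral_gaussGiventalIntegrand_inner x h₁₂ h₂₃ p.1 p.2

theorem mainTheorem3 (γ : Fin 3 → ℂ) (x : Fin 3 → ℝ)
    (hγ : ∀ i, (γ i).im < 1 / 2)
    (h₁₂ : -(1 / 2) < (γ 0 - γ 1).im) (h₂₃ : -(1 / 2) < (γ 1 - γ 2).im) :
    Integrable (gaussGiventalIntegrand γ x) ∧
    Integrable (mellinBarnesIntegrand γ x) ∧
    gaussGiventalIntegral γ x = 1 / 2 * mellinBarnesIntegral γ x := by
  refine ⟨integrable_gaussGiventalIntegrand x h₁₂ h₂₃, integrable_mellinBarnesIntegrand x hγ, ?_⟩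
  have h := integral_gaussGiventalIntegrand x h₁₂ h₂₃
  rw [integral_whittakerKernel_shift x hγ h₁₂ h₂₃] at h
  -- The quotient of the two prefactors is precisely the exponential produced by the Gauss–Givental
  -- reduction.
  rw [gaussGiventalIntegral, mellinBarnesIntegral, integral_mellinBarnesIntegrand x hγ,
    show I * (γ 0 * x 0 + γ 1 * x 1 + γ 2 * x 2) - x 0 + x 2 =
      (I * (γ 0 + γ 1 + γ 2) * x 2 - (x 0 - x 2)) +
      (I * (x 0 - x 1) * γ 0 + I * (x 1 - x 2) * (γ 0 + γ 1)) by ring, exp_add, mul_div_right_comm,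
    mul_assoc, h]
  ring
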